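/- Let $n\ge 0$ be an integer, let $0<\zeta_1<\dots<\zeta_n$ be constants, and let $b_1,\dots,b_n:\mathbb R\to\mathbb R$ satisfy $\dot b_j(t)=\zeta_j b_j(t)$ for all $t\in\mathbb R$ and $b_j(0)>0$. For every $k\in\mathbb Z$ put $$\tau_k(t)=\sum_{J\subseteq\{1,\dots,n\},\ |J|=k} b_J(t)\,\frac{\Delta_J^2}{\Gamma_J},\qquad b_J=\prod_{j\in J}b_j,\quad \Delta_J=\prod_{i,j\in J,\ i<j}(\zeta_j-\zeta_i),\quad \Gamma_J=\prod_{i,j\in J,\ i<j}(\zeta_j+\zeta_i).$$ For an antisymmetric $2N\times 2N$ matrix with entries $(x_i,x_j)$, $1\le i,j\le 2N$, its Pfaffian is $$(x_1,\dots,x_{2N})=\sum_{\sigma}\operatorname{sgn}(\sigma)\prod_{l=1}^{N}(x_{\sigma(2l-1)},x_{\sigma(2l)}),$$ the sum being over the permutations $\sigma$ of $\{1,\dots,2N\}$ with $\sigma(2l-1)<\sigma(2l)$ for all $l$ and $\sigma(1)<\sigma(3)<\dots<\sigma(2N-1)$; it equals $1$ for $N=0$. Put $f_i(t)=\sum_{j=1}^n\zeta_j^{\,i}b_j(t)$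 and, for integers $i,j\ge 0$, $$(d_0,i)=-(i,d_0)=f_i(t),\qquad (d_0,d_0)=0,\qquad (i,j)=\iint_{-\infty<t_1<t_2<t}\bigl[f_{i+1}(t_1)f_{j+1}(t_2)-f_{i+1}(t_2)f_{j+1}(t_1)\bigr]\,dt_1\,dt_2 .$$ Then these integrals converge absolutely, and: 1. $\tau_k=0$ for $k<0$ and for $k>n$; in particular $\tau_{-1}=\tau_{n+1}=0$. 2. For all $t\in\mathbb R$, $\tau_{2N}=(0,1,\dots,2N-1)$ for every $N\ge 0$, and $\tau_{2N-1}=(d_0,0,1,\dots,2N-2)$ for every $N\ge 1$. 3. The functions $\tau_k$ are twice continuously differentiable on $\mathbb R$ and satisfy the finite bilinear B-Toda lattice $$\ddot\tau_k\,\tau_k-(\dot\tau_k)^2=\tau_{k-1}\,\dot\tau_{k+1}-\dot\tau_{k-1}\,\tau_{k+1},\qquad k=0,1,\dots,n .$$ -/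

import Mathlib

open MeasureTheory

noncomputable section

namespace BToda

/-- `Δ_J`: the product of `ζ_j - ζ_i` over all `i < j` in `J`. -/
def Delta {n : ℕ} (ζ : Fin n → ℝ) (J : Finset (Fin n)) : ℝ :=
  ∏ p ∈ J ×ˢ J with p.1 < p.2, (ζ p.2 - ζ p.1)

/-- `Γ_J`: the product of `ζ_j + ζ_i` over all `i < j` in `J`. -/
def Gam {n : ℕ} (ζ : Fin n → ℝ) (J : Finset (Fin n)) : ℝ :=
  ∏ p ∈ J ×ˢ J with p.1 < p.2, (ζ p.2 + ζ p.1)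

/-- `τ_k(t)`, for every integer `k`: the sum over the `k`-element subsets `J` of the index set
of `b_J(t) Δ_J² / Γ_J`. For `k < 0` and for `k > n` the sum is empty. -/
def tau {n : ℕ} (ζ : Fin n → ℝ) (b : Fin n → ℝ → ℝ) (k : ℤ) (t : ℝ) : ℝ :=
  ∑ J : Finset (Fin n) with (J.card : ℤ) = k,
    (∏ j ∈ J, b j t) * (Delta ζ J) ^ 2 / Gam ζ J

/-- The moments `f_i(t) = ∑_j ζ_j ^ i b_j(t)`. -/
def moment {n : ℕ} (ζ : Fin n → ℝ) (b : Fin n → ℝ → ℝ) (i : ℕ) (t : ℝ) : ℝ :=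
  ∑ j, ζ j ^ i * b j t

/-- The permutations `i_1, i_2, …, i_{2N}` of `2N` indices that list a decomposition into pairs
in standard form: each pair is increasing, and the first elements of the pairs increase. -/
def IsPairing {N : ℕ} (σ : Equiv.Perm (Fin (2 * N))) : Prop :=
  (∀ l : Fin N, σ ⟨2 * l, by omega⟩ < σ ⟨2 * l + 1, by omega⟩) ∧
    ∀ l m : Fin N, l < m → σ ⟨2 * l, by omega⟩ < σ ⟨2 * m, by omega⟩

open Classical in
/-- The Pfaffian of an antisymmetric matrix of size `2N`: the signed sum over all decompositions
of the indices into pairs. -/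
def pfaffian {N : ℕ} (A : Matrix (Fin (2 * N)) (Fin (2 * N)) ℝ) : ℝ :=
  ∑ σ : Equiv.Perm (Fin (2 * N)) with IsPairing σ,
    ((Equiv.Perm.sign σ : ℤ) : ℝ) *
      ∏ l : Fin N, A (σ ⟨2 * l, by omega⟩) (σ ⟨2 * l + 1, by omega⟩)

/-- The region `-∞ < t₁ < t₂ < t`. -/
def region (t : ℝ) : Set (ℝ × ℝ) := {p | p.1 < p.2 ∧ p.2 < t}

/-- The integrand of the entry `(i, j)`. -/
def entryIntegrand {n : ℕ} (ζ : Fin n → ℝ) (b : Fin n → ℝ → ℝ) (i j : ℕ) (p : ℝ × ℝ) : ℝ :=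
  moment ζ b (i + 1) p.1 * moment ζ b (j + 1) p.2 -
    moment ζ b (i + 1) p.2 * moment ζ b (j + 1) p.1

/-- The Pfaffian entry `(i, j)` at time `t`. -/
def entry {n : ℕ} (ζ : Fin n → ℝ) (b : Fin n → ℝ → ℝ) (t : ℝ) (i j : ℕ) : ℝ :=
  ∫ p in region t, entryIntegrand ζ b i j p

/-- The entries on the indices `d₀, 0, 1, 2, …`, where `d₀` is listed first (position `0`) and
the index `i` has position `i + 1`; `(d₀, i) = f_i(t)`. -/
def entryD {n : ℕ} (ζ : Fin n → ℝ) (b : Fin n → ℝ → ℝ) (t : ℝ) : ℕ → ℕ → ℝ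
  | 0, 0 => 0
  | 0, j + 1 => moment ζ b j t
  | i + 1, 0 => -moment ζ b i t
  | i + 1, j + 1 => entry ζ b t i j

/-- The Pfaffian `(0, 1, …, 2N - 1)` (equal to `1` for `N = 0`). -/
def pfEven {n : ℕ} (ζ : Fin n → ℝ) (b : Fin n → ℝ → ℝ) (N : ℕ) (t : ℝ) : ℝ :=
  pfaffian (N := N) (Matrix.of fun x y => entry ζ b t (x : ℕ) (y : ℕ))

/-- The Pfaffian `(d₀, 0, 1, …, 2N - 2)`, used for `N ≥ 1`. -/
def pfOdd {n : ℕ} (ζ : Fin n → ℝ) (b : Fin n → ℝ → ℝ) (N : ℕ) (t : ℝ) : ℝ :=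
  pfaffian (N := N) (Matrix.of fun x y => entryD ζ b t (x : ℕ) (y : ℕ))

end BToda

end

/-!
Solving the flow gives `b_j(t) = b_j(0) exp (ζ_j t)`, so each derivative of `τ_k` multiplies the
term of `J` by `s_J = ∑_{j ∈ J} ζ_j`.

**The Pfaffians.** Integration gives `(i, j) = ∑_{p, q} ζ_p^i ζ_q^j b_p b_q S_{pq}` with Schur's
matrix `S_{pq} = (ζ_q - ζ_p) / (ζ_q + ζ_p)` (`entry_eq`). The Pfaffian of such a product expands,
as in the Cauchy–Binet formula, into a sum over sets `J` of nodes of a Vandermonde minor `Δ_J`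
times Schur's Pfaffian `Δ_J / Γ_J` (`pfaffian_eq_sum_minors`, `sum_perm_schur`). The bordered
Pfaffian with the index `d₀` is of the same form, with an additional node `0`. Pfaffians are
handled as sums over all permutations, which count every pairing once for each of the `2^N N!`
permutations of the blocks and of the positions in them (`sum_perm_eq_pfaffian`). Schur's formula
holds up to a constant since, with denominators cleared, both sides are antisymmetric polynomials
of the degree of the Vandermonde product; the constant is read off at the nodes `-1, 1, -2, 2, …`.

**The lattice.** Both sides of the bilinear equation are sums over pairs `(J, K)` of index sets.
Collecting the pairs with given intersection `C` and symmetric difference `D` leaves a sum over the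
splittings of `D` into two parts (`sum_splitWeight_mul_eq_zero`). This sum, cleared of denominators,
is a symmetric polynomial in the nodes of `D`; if two nodes coincide it reduces to the same sum for
the remaining nodes (`splitSum_insert_insert`). By induction it is divisible by `Δ_D²`, and it is
zero because its degree is too small (`splitSum_X_eq_zero`).
-/

namespace BToda

/-! ### Products over pairs -/

/-- The product of `g i j` over all `i < j` in `J`. -/
def pairProd {ι R : Type*} [LinearOrder ι] [CommMonoid R] (g : ι → ι → R) (J : Finset ι) : R :=
  ∏ p ∈ J ×ˢ J with p.1 < p.2, g p.1 p.2

section PairProd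

variable {ι κ R S : Type*} [LinearOrder ι] [LinearOrder κ] [CommMonoid R] [CommMonoid S]

theorem pairProd_eq (g : ι → ι → R) (J : Finset ι) :
    pairProd g J = ∏ i ∈ J, ∏ j ∈ J, if i < j then g i j else 1 := by
  rw [pairProd, Finset.prod_filter, Finset.prod_product]

@[simp]
theorem pairProd_empty (g : ι → ι → R) : pairProd g ∅ = 1 := by
  simp [pairProd]

theorem pairProd_mul (g h : ι → ι → R) (J : Finset ι) :
    pairProd (fun i j => g i j * h i j) J = pairProd g J * pairProd h J :=
  Finset.prod_mul_distrib

theorem map_pairProd {F : Type*} [FunLike F R S] [MonoidHomClass F R S] (φ : F) (g : ι → ι → R)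
    (J : Finset ι) : φ (pairProd g J) = pairProd (fun i j => φ (g i j)) J :=
  map_prod φ _ _

theorem pairProd_congr {g h : ι → ι → R} {J : Finset ι}
    (H : ∀ i ∈ J, ∀ j ∈ J, i < j → g i j = h i j) : pairProd g J = pairProd h J := by
  refine Finset.prod_congr rfl fun p hp => ?_
  simp only [Finset.mem_filter, Finset.mem_product] at hp
  exact H _ hp.1.1 _ hp.1.2 hp.2

theorem pairProd_insert {g : ι → ι → R} (hg : ∀ i j, g i j = g j i) {a : ι} {J : Finset ι}
    (ha : a ∉ J) : pairProd g (insert a J) = (∏ j ∈ J, g a j) * pairProd g J := by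
  simp only [pairProd_eq]
  rw [Finset.prod_insert ha, Finset.prod_insert ha, if_neg (lt_irrefl a), one_mul]
  have h1 : ∀ i ∈ J, (∏ j ∈ insert a J, if i < j then g i j else 1) =
      (if i < a then g a i else 1) * ∏ j ∈ J, if i < j then g i j else 1 := by
    intro i _
    rw [Finset.prod_insert ha, hg i a]
  rw [Finset.prod_congr rfl h1, Finset.prod_mul_distrib, ← mul_assoc, ← Finset.prod_mul_distrib]
  congr 1
  refine Finset.prod_congr rfl fun j hj => ?_
  have hne : a ≠ j := fun h => ha (h ▸ hj)
  rcases lt_or_gt_of_ne hne with h | h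
  · simp [h, h.not_gt]
  · simp [h, h.not_gt]

theorem pairProd_union {g : ι → ι → R} (hg : ∀ i j, g i j = g j i) {J K : Finset ι}
    (h : Disjoint J K) :
    pairProd g (J ∪ K) = pairProd g J * pairProd g K * ∏ j ∈ J, ∏ k ∈ K, g j k := by
  induction J using Finset.induction_on with
  | empty => simp
  | insert a J ha ih =>
    rw [Finset.disjoint_insert_left] at h
    have ha' : a ∉ J ∪ K := by simp [ha, h.1]
    rw [Finset.insert_union, pairProd_insert hg ha', ih h.2, pairProd_insert hg ha,
      Finset.prod_insert ha, Finset.prod_union h.2]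
    simp only [mul_assoc, mul_left_comm, mul_comm]

theorem pairProd_image {g : κ → κ → R} (hg : ∀ i j, g i j = g j i) {σ : ι → κ}
    (hσ : Function.Injective σ) (J : Finset ι) :
    pairProd g (J.image σ) = pairProd (fun i j => g (σ i) (σ j)) J := by
  induction J using Finset.induction_on with
  | empty => simp
  | insert a J ha ih =>
    have ha' : σ a ∉ J.image σ := by
      simpa [hσ.eq_iff] using ha
    rw [Finset.image_insert, pairProd_insert hg ha', ih, pairProd_insert (fun i j => hg _ _) ha,
      Finset.prod_image fun i _ j _ h => hσ h]

theorem pairProd_image_of_strictMono (g : κ → κ → R) {σ : ι → κ}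
    (hσ : StrictMono σ) (J : Finset ι) :
    pairProd g (J.image σ) = pairProd (fun i j => g (σ i) (σ j)) J := by
  simp only [pairProd_eq]
  simp only [Finset.prod_image fun i _ j _ h => hσ.injective h, hσ.lt_iff_lt]

end PairProd

/-! ### Divisibility by Vandermonde products -/

section Divisibility

open MvPolynomial

variable {ι : Type*}

theorem X_sub_X_dvd_of_aeval_eq_zero [DecidableEq ι] {a b : ι} (P : MvPolynomial ι ℝ)
    (h : aeval (Function.update (X : ι → MvPolynomial ι ℝ) a (X b)) P = 0) :
    (X a - X b : MvPolynomial ι ℝ) ∣ P := by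
  rw [← Ideal.mem_span_singleton, ← Ideal.Quotient.eq_zero_iff_mem]
  let I := Ideal.span {(X a - X b : MvPolynomial ι ℝ)}
  have key : (Ideal.Quotient.mkₐ ℝ I).comp
      (aeval (Function.update (X : ι → MvPolynomial ι ℝ) a (X b))) = Ideal.Quotient.mkₐ ℝ I := by
    ext i
    by_cases hi : i = a
    · subst hi
      simp only [AlgHom.comp_apply, aeval_X, Function.update_self, Ideal.Quotient.mkₐ_eq_mk]
      rw [eq_comm, Ideal.Quotient.eq]
      exact Ideal.mem_span_singleton_self _
    · simp [Function.update_of_ne hi]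
  have := DFunLike.congr_fun key P
  rw [AlgHom.comp_apply, h, map_zero] at this
  exact this.symm

theorem aeval_update_rename_swap [DecidableEq ι] (a b : ι) (P : MvPolynomial ι ℝ) :
    aeval (Function.update (X : ι → MvPolynomial ι ℝ) a (X b)) (rename (Equiv.swap a b) P) =
      aeval (Function.update (X : ι → MvPolynomial ι ℝ) a (X b)) P := by
  rw [aeval_rename]
  congr 2
  funext i
  rcases eq_or_ne i a with rfl | ha
  · by_cases h : b = i <;> simp [Function.update_apply]
  · rcases eq_or_ne i b with rfl | hb
    · simp [ha]
    · simp [ha, Equiv.swap_apply_of_ne_of_ne ha hb]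

theorem X_sub_X_dvd_of_rename_swap_eq_neg [DecidableEq ι] {a b : ι} {P : MvPolynomial ι ℝ}
    (h : rename (Equiv.swap a b) P = -P) : (X a - X b : MvPolynomial ι ℝ) ∣ P := by
  apply X_sub_X_dvd_of_aeval_eq_zero
  have h1 := aeval_update_rename_swap a b P
  rw [h, map_neg, neg_eq_iff_add_eq_zero, ← two_mul] at h1
  exact (mul_eq_zero.mp h1).resolve_left two_ne_zero

/-- A polynomial that is symmetric in two variables and vanishes when they are equal is divisible
by the square of their difference: the quotient by the difference is antisymmetric. -/
theorem X_sub_X_sq_dvd [DecidableEq ι] {a b : ι} (hab : a ≠ b) {P : MvPolynomial ι ℝ}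
    (hs : rename (Equiv.swap a b) P = P)
    (h : aeval (Function.update (X : ι → MvPolynomial ι ℝ) a (X b)) P = 0) :
    (X a - X b : MvPolynomial ι ℝ) ^ 2 ∣ P := by
  obtain ⟨Q, rfl⟩ := X_sub_X_dvd_of_aeval_eq_zero P h
  have hne : (X a - X b : MvPolynomial ι ℝ) ≠ 0 :=
    sub_ne_zero.mpr fun h => hab (X_injective h)
  rw [map_mul, map_sub, rename_X, rename_X, Equiv.swap_apply_left, Equiv.swap_apply_right] at hs
  have hQ : rename (Equiv.swap a b) Q = -Q := by
    apply mul_left_cancel₀ hne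
    linear_combination -hs
  rw [pow_two]
  exact mul_dvd_mul_left _ (X_sub_X_dvd_of_rename_swap_eq_neg hQ)

theorem totalDegree_X_sub_X {a b : ι} (hab : a ≠ b) :
    (X a - X b : MvPolynomial ι ℝ).totalDegree = 1 := by
  apply le_antisymm
  · exact (totalDegree_sub _ _).trans (by simp)
  · have hc : coeff (Finsupp.single a 1) (X a - X b : MvPolynomial ι ℝ) ≠ 0 := by
      classical
      simp [coeff_X, Finsupp.single_left_inj, hab.symm]
    simpa using le_totalDegree (mem_support_iff.mpr hc)

theorem totalDegree_prod_eq_card {α : Type*} {s : Finset α} {f : α → MvPolynomial ι ℝ}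
    (h : ∀ i ∈ s, (f i).totalDegree = 1) : (∏ i ∈ s, f i).totalDegree = s.card := by
  classical
  have h0 : ∀ i ∈ s, f i ≠ 0 := fun i hi h1 => by simpa [h1] using h i hi
  induction s using Finset.induction_on with
  | empty => simp
  | insert a s ha ih =>
    rw [Finset.forall_mem_insert] at h h0
    rw [Finset.prod_insert ha,
      totalDegree_mul_of_isDomain h0.1 (Finset.prod_ne_zero_iff.mpr h0.2), h.1, ih h.2 h0.2,
      Finset.card_insert_of_notMem ha, add_comm]

theorem prime_X_sub_X {a b : ι} (hab : a ≠ b) : Prime (X a - X b : MvPolynomial ι ℝ) := by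
  classical
  rw [← UniqueFactorizationMonoid.irreducible_iff_prime]
  refine irreducible_of_totalDegree_eq_one (totalDegree_X_sub_X hab) fun x hx => ?_
  have := hx (Finsupp.single a 1)
  simp only [coeff_sub, coeff_X, Finsupp.single_left_inj one_ne_zero, hab.symm, if_true,
    if_false, sub_zero] at this
  exact isUnit_of_dvd_one this

theorem isRelPrime_X_sub_X {a b c d : ι} (hab : a ≠ b) (hcd : c ≠ d)
    (h : ¬ (a = c ∧ b = d)) (h' : ¬ (a = d ∧ b = c)) :
    IsRelPrime (X a - X b : MvPolynomial ι ℝ) (X c - X d) := by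
  classical
  rw [(prime_X_sub_X hab).irreducible.isRelPrime_iff_not_dvd]
  rintro ⟨Q, hQ⟩
  have h2 := congrArg (aeval (Function.update (X : ι → MvPolynomial ι ℝ) a (X b))) hQ
  simp only [map_sub, map_mul, aeval_X, Function.update_self, Function.update_of_ne hab.symm,
    sub_self, zero_mul, sub_eq_zero] at h2
  simp only [Function.update_apply] at h2
  split_ifs at h2 with h3 h4 h4
  · exact hcd (h3.trans h4.symm)
  · exact h ⟨h3.symm, X_injective h2⟩
  · exact h' ⟨h4.symm, (X_injective h2).symm⟩
  · exact hcd (X_injective h2)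

theorem pairProd_X_sub_X_dvd [LinearOrder ι] {e : ℕ} {D : Finset ι} {P : MvPolynomial ι ℝ}
    (h : ∀ a ∈ D, ∀ b ∈ D, a < b → (X b - X a : MvPolynomial ι ℝ) ^ e ∣ P) :
    pairProd (fun a b => (X b - X a : MvPolynomial ι ℝ) ^ e) D ∣ P := by
  refine Finset.prod_dvd_of_isRelPrime ?_ ?_
  · intro p hp q hq hpq
    simp only [Finset.coe_filter, Finset.mem_product, Set.mem_ofPred_eq] at hp hq
    refine IsRelPrime.pow (isRelPrime_X_sub_X hp.2.ne' hq.2.ne' ?_ ?_)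
    · rintro ⟨h1, h2⟩
      exact hpq (Prod.ext h2 h1)
    · rintro ⟨h1, h2⟩
      have := hp.2
      rw [h1, h2] at this
      exact this.not_gt hq.2
  · intro p hp
    simp only [Finset.mem_filter, Finset.mem_product] at hp
    exact h _ hp.1.1 _ hp.1.2 hp.2

theorem totalDegree_pairProd_sq [LinearOrder ι] (D : Finset ι) :
    (pairProd (fun a b => (X b - X a : MvPolynomial ι ℝ) ^ 2) D).totalDegree
      = D.card * (D.card - 1) ∧
    pairProd (fun a b => (X b - X a : MvPolynomial ι ℝ) ^ 2) D ≠ 0 := by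
  induction D using Finset.induction_on with
  | empty => simp
  | insert a D ha ih =>
    have hne : ∀ j ∈ D, (X j - X a : MvPolynomial ι ℝ) ^ 2 ≠ 0 := fun j hj =>
      pow_ne_zero _ (sub_ne_zero.mpr fun h => ha (X_injective h ▸ hj))
    have hdeg : (∏ j ∈ D, (X j - X a : MvPolynomial ι ℝ) ^ 2).totalDegree = 2 * D.card := by
      have h0 : ∏ j ∈ D, (X j - X a : MvPolynomial ι ℝ) ≠ 0 :=
        Finset.prod_ne_zero_iff.mpr fun j hj => pow_ne_zero_iff two_ne_zero |>.mp (hne j hj)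
      rw [Finset.prod_pow, pow_two, totalDegree_mul_of_isDomain h0 h0,
        totalDegree_prod_eq_card fun j hj =>
          totalDegree_X_sub_X (ne_of_mem_of_not_mem hj ha), two_mul]
    have hp := Finset.prod_ne_zero_iff.mpr hne
    rw [pairProd_insert (fun i j => by ring) ha]
    refine ⟨?_, mul_ne_zero hp ih.2⟩
    rw [totalDegree_mul_of_isDomain hp ih.2, ih.1, hdeg,
      Finset.card_insert_of_notMem ha]
    rcases D.card with _ | m
    · rfl
    · simp only [Nat.add_sub_cancel]; ring

end Divisibility

/-! ### The bilinear identity for symmetric sums over splittings -/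

section Bilinear

variable {ι R S : Type*} [LinearOrder ι] [CommRing R] [CommRing S]

/-- For disjoint `J` and `K`, this is the product of the numerators `Δ_J² Δ_K²` with the factors
`x_j + x_k` (`j ∈ J`, `k ∈ K`); equivalently, it is `Γ_{J ∪ K}` times `Δ_J² / Γ_J · Δ_K² / Γ_K`. -/
def splitTerm (x : ι → R) (J K : Finset ι) : R :=
  pairProd (fun i j => (x j - x i) ^ 2) J * pairProd (fun i j => (x j - x i) ^ 2) K *
    ∏ j ∈ J, ∏ k ∈ K, (x j + x k)

/-- Twice the weight with which a product `b_J b_K` enters the bilinear lattice equation: the left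
side of the equation contributes when `|J| = |K|`, the right side when `|J| = |K| + 2`. -/
def splitWeight (x : ι → R) (J K : Finset ι) : R :=
  if J.card = K.card then (∑ j ∈ J, x j - ∑ k ∈ K, x k) ^ 2
  else if J.card = K.card + 2 then -2 * (∑ j ∈ J, x j - ∑ k ∈ K, x k) else 0

/-- The weighted sum over all ways to split `D` into two parts `J` and `D \ J`. -/
def splitSum (x : ι → R) (D : Finset ι) : R :=
  ∑ J ∈ D.powerset, splitWeight x J (D \ J) * splitTerm x J (D \ J)

theorem splitTerm_insert_left (x : ι → R) {a : ι} {J : Finset ι} (K : Finset ι) (ha : a ∉ J) :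
    splitTerm x (insert a J) K =
      (∏ j ∈ J, (x j - x a) ^ 2) * (∏ k ∈ K, (x a + x k)) * splitTerm x J K := by
  rw [splitTerm, splitTerm, pairProd_insert (fun i j => by ring) ha, Finset.prod_insert ha]
  ring

theorem splitTerm_insert_right (x : ι → R) {a : ι} (J : Finset ι) {K : Finset ι} (ha : a ∉ K) :
    splitTerm x J (insert a K) =
      (∏ k ∈ K, (x k - x a) ^ 2) * (∏ j ∈ J, (x j + x a)) * splitTerm x J K := by
  rw [splitTerm, splitTerm, pairProd_insert (fun i j => by ring) ha]
  simp only [Finset.prod_insert ha, Finset.prod_mul_distrib]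
  ring

theorem map_splitTerm (φ : R →+* S) (x : ι → R) (J K : Finset ι) :
    φ (splitTerm x J K) = splitTerm (φ ∘ x) J K := by
  simp [splitTerm, map_pairProd]

omit [LinearOrder ι] in
theorem map_splitWeight (φ : R →+* S) (x : ι → R) (J K : Finset ι) :
    φ (splitWeight x J K) = splitWeight (φ ∘ x) J K := by
  simp only [splitWeight]
  split_ifs <;> simp [map_ofNat]

theorem map_splitSum (φ : R →+* S) (x : ι → R) (D : Finset ι) :
    φ (splitSum x D) = splitSum (φ ∘ x) D := by
  simp [splitSum, map_splitTerm, map_splitWeight]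

theorem splitTerm_comp_equiv (x : ι → R) (σ : Equiv.Perm ι) (J K : Finset ι) :
    splitTerm (x ∘ σ) J K = splitTerm x (J.image σ) (K.image σ) := by
  rw [splitTerm, splitTerm, pairProd_image (fun i j => by ring) σ.injective,
    pairProd_image (fun i j => by ring) σ.injective, Finset.prod_image σ.injective.injOn]
  simp only [Finset.prod_image σ.injective.injOn, Function.comp_apply]

theorem splitWeight_comp_equiv (x : ι → R) (σ : Equiv.Perm ι) (J K : Finset ι) :
    splitWeight (x ∘ σ) J K = splitWeight x (J.image σ) (K.image σ) := by
  simp only [splitWeight, Finset.card_image_of_injective _ σ.injective,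
    Finset.sum_image σ.injective.injOn, Function.comp_apply]

theorem splitSum_comp_equiv (x : ι → R) (σ : Equiv.Perm ι) (D : Finset ι) :
    splitSum (x ∘ σ) D = splitSum x (D.image σ) := by
  rw [splitSum, splitSum, Finset.powerset_image,
    Finset.sum_image (Finset.image_injective σ.injective).injOn]
  refine Finset.sum_congr rfl fun J _ => ?_
  rw [splitTerm_comp_equiv, splitWeight_comp_equiv, Finset.image_sdiff _ _ σ.injective]

theorem splitWeight_insert_insert {x : ι → R} {a b : ι} {J K : Finset ι} (h : x a = x b)
    (ha : a ∉ J) (hb : b ∉ K) :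
    splitWeight x (insert a J) (insert b K) = splitWeight x J K := by
  simp only [splitWeight, Finset.card_insert_of_notMem ha, Finset.card_insert_of_notMem hb,
    Finset.sum_insert ha, Finset.sum_insert hb, h, add_sub_add_left_eq_sub,
    Nat.add_right_cancel_iff, add_right_comm _ 1 2]

theorem splitTerm_insert_insert {x : ι → R} {a b : ι} {J K : Finset ι} (h : x a = x b)
    (haJ : a ∉ J) (hbK : b ∉ K) (hJK : Disjoint J K) :
    splitTerm x (insert a J) (insert b K) =
      2 * x a * (∏ d ∈ J ∪ K, ((x d - x a) ^ 2 * (x d + x a))) * splitTerm x J K := by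
  rw [splitTerm_insert_left _ _ haJ, splitTerm_insert_right _ _ hbK, Finset.prod_insert hbK,
    Finset.prod_union hJK, ← h]
  simp only [Finset.prod_mul_distrib, add_comm (x a) (x _)]
  ring

theorem splitTerm_eq_zero_left {x : ι → R} {a b : ι} {J K : Finset ι} (h : x a = x b)
    (hab : a ≠ b) (haJ : a ∉ J) (hbJ : b ∉ J) :
    splitTerm x (insert a (insert b J)) K = 0 := by
  rw [splitTerm_insert_left _ _ (by simp [hab, haJ]), Finset.prod_insert hbJ, h]
  ring

theorem splitTerm_eq_zero_right {x : ι → R} {a b : ι} {J K : Finset ι} (h : x a = x b)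
    (hab : a ≠ b) (haK : a ∉ K) (hbK : b ∉ K) :
    splitTerm x J (insert a (insert b K)) = 0 := by
  rw [splitTerm_insert_right _ _ (by simp [hab, haK]), Finset.prod_insert hbK, h]
  ring

/-- When two nodes coincide, only the splittings that separate them contribute, and the sum
reduces to the one without these two nodes. -/
theorem splitSum_insert_insert {x : ι → R} {a b : ι} {D : Finset ι} (h : x a = x b)
    (hab : a ≠ b) (ha : a ∉ D) (hb : b ∉ D) :
    splitSum x (insert a (insert b D)) =
      4 * x a * (∏ d ∈ D, ((x d - x a) ^ 2 * (x d + x a))) * splitSum x D := by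
  have ha' : a ∉ insert b D := by simp [hab, ha]
  rw [splitSum, Finset.sum_powerset_insert ha', Finset.sum_powerset_insert hb,
    Finset.sum_powerset_insert hb, splitSum, Finset.mul_sum, ← Finset.sum_add_distrib,
    ← Finset.sum_add_distrib, ← Finset.sum_add_distrib]
  refine Finset.sum_congr rfl fun J hJ => ?_
  rw [Finset.mem_powerset] at hJ
  have haJ : a ∉ J := fun h => ha (hJ h)
  have hbJ : b ∉ J := fun h => hb (hJ h)
  have haK : a ∉ D \ J := fun h => ha (Finset.mem_sdiff.mp h).1
  have hbK : b ∉ D \ J := fun h => hb (Finset.mem_sdiff.mp h).1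
  have e1 : insert a (insert b D) \ J = insert a (insert b (D \ J)) := by
    rw [Finset.insert_sdiff_of_notMem _ haJ, Finset.insert_sdiff_of_notMem _ hbJ]
  have e2 : insert a (insert b D) \ insert b J = insert a (D \ J) := by
    ext i; simp only [Finset.mem_sdiff, Finset.mem_insert]; grind
  have e3 : insert a (insert b D) \ insert a J = insert b (D \ J) := by
    ext i; simp only [Finset.mem_sdiff, Finset.mem_insert]; grind
  have e4 : insert a (insert b D) \ insert a (insert b J) = D \ J := by
    ext i; simp only [Finset.mem_sdiff, Finset.mem_insert]; grind
  have hu : J ∪ D \ J = D := Finset.union_sdiff_of_subset hJ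
  have hd : Disjoint J (D \ J) := Finset.disjoint_sdiff
  rw [e1, e2, e3, e4, splitTerm_eq_zero_left h hab haJ hbJ, splitTerm_eq_zero_right h hab haK hbK,
    splitWeight_insert_insert h haJ hbK, splitWeight_insert_insert h.symm hbJ haK,
    splitTerm_insert_insert h haJ hbK hd,
    splitTerm_insert_insert h.symm hbJ haK hd, hu, ← h]
  ring

end Bilinear

section Degree

open MvPolynomial

variable {ι : Type*} [LinearOrder ι]

theorem totalDegree_splitTerm_le (J K : Finset ι) :
    (splitTerm (X : ι → MvPolynomial ι ℝ) J K).totalDegree ≤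
      J.card * (J.card - 1) + K.card * (K.card - 1) + J.card * K.card := by
  refine (totalDegree_mul _ _).trans (add_le_add ((totalDegree_mul _ _).trans
    (add_le_add (totalDegree_pairProd_sq J).1.le (totalDegree_pairProd_sq K).1.le)) ?_)
  refine (totalDegree_finsetProd _ _).trans ?_
  refine (Finset.sum_le_card_nsmul _ _ K.card fun j _ => ?_).trans (by simp)
  refine (totalDegree_finsetProd _ _).trans ?_
  refine (Finset.sum_le_card_nsmul _ _ 1 fun k _ => ?_).trans (by simp)
  exact (totalDegree_add _ _).trans (by simp)

omit [LinearOrder ι] in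
theorem totalDegree_sum_X_sub_sum_X_le (J K : Finset ι) :
    (∑ j ∈ J, X j - ∑ k ∈ K, X k : MvPolynomial ι ℝ).totalDegree ≤ 1 := by
  refine (totalDegree_sub _ _).trans (max_le ?_ ?_) <;>
    exact totalDegree_finsetSum_le fun i _ => by simp

/-- The degree of the sum over splittings is smaller than that of the squared Vandermonde product.
With `|D| = 2m`, every term has degree at most `3m² - 2m + 2`, while `Δ_D²` has degree
`4m² - 2m`. -/
theorem totalDegree_splitSum_lt {D : Finset ι} (hD : 3 ≤ D.card) :
    (splitSum (X : ι → MvPolynomial ι ℝ) D).totalDegree < D.card * (D.card - 1) := by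
  have hpos : 0 < D.card * (D.card - 1) := Nat.mul_pos (by omega) (by omega)
  rw [← Nat.le_sub_one_iff_lt hpos]
  refine totalDegree_finsetSum_le fun J hJ => ?_
  rw [Nat.le_sub_one_iff_lt hpos]
  have hc : J.card + (D \ J).card = D.card :=
    by
    rw [add_comm]; exact Finset.card_sdiff_add_card_eq_card (Finset.mem_powerset.mp hJ)
  have hT := totalDegree_splitTerm_le J (D \ J)
  have hL := totalDegree_sum_X_sub_sum_X_le J (D \ J)
  generalize hKdef : D \ J = K at hc hT hL ⊢
  rw [splitWeight]
  split_ifs with h1 h2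
  · have h3 := (totalDegree_mul ((∑ j ∈ J, X j - ∑ k ∈ K, X k : MvPolynomial ι ℝ) ^ 2)
      (splitTerm X J K))
    have h4 := totalDegree_pow (∑ j ∈ J, X j - ∑ k ∈ K, X k : MvPolynomial ι ℝ) 2
    rw [← hc] at hD ⊢
    rw [h1] at hD hT ⊢
    obtain ⟨s, hs⟩ : ∃ s, K.card = s + 2 := ⟨K.card - 2, by omega⟩
    rw [hs] at hT ⊢
    have : (s + 2) * (s + 2 - 1) + (s + 2) * (s + 2 - 1) + (s + 2) * (s + 2) + 2 <
        (s + 2 + (s + 2)) * (s + 2 + (s + 2) - 1) := by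
      have e1 : s + 2 - 1 = s + 1 := by omega
      have e2 : s + 2 + (s + 2) - 1 = 2 * s + 3 := by omega
      rw [e1, e2]; nlinarith
    omega
  · have h3 := (totalDegree_mul (-2 * (∑ j ∈ J, X j - ∑ k ∈ K, X k) : MvPolynomial ι ℝ)
      (splitTerm X J K))
    have h4 := totalDegree_mul (-2) (∑ j ∈ J, X j - ∑ k ∈ K, X k : MvPolynomial ι ℝ)
    have h5 : (-2 : MvPolynomial ι ℝ).totalDegree = 0 := by
      rw [← map_ofNat (C : ℝ →+* MvPolynomial ι ℝ) 2, ← map_neg, totalDegree_C]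
    rw [← hc] at hD ⊢
    rw [h2] at hD hT ⊢
    obtain ⟨s, hs⟩ : ∃ s, K.card = s + 1 := ⟨K.card - 1, by omega⟩
    rw [hs] at hT ⊢
    have : (s + 1 + 2) * (s + 1 + 2 - 1) + (s + 1) * (s + 1 - 1) + (s + 1 + 2) * (s + 1) + 1 <
        (s + 1 + 2 + (s + 1)) * (s + 1 + 2 + (s + 1) - 1) := by
      have e1 : s + 1 + 2 - 1 = s + 2 := by omega
      have e2 : s + 1 + 2 + (s + 1) - 1 = 2 * s + 3 := by omega
      rw [e1, e2, Nat.add_sub_cancel]; nlinarith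
    omega
  · rw [zero_mul, totalDegree_zero]
    exact hpos

/-- By induction on `|D|` the polynomial vanishes when two nodes coincide. Being symmetric, it is
then divisible by `Δ_D²`, and for `|D| ≥ 3` its degree is too small for that; the smaller cases are
explicit. -/
theorem splitSum_X_eq_zero (D : Finset ι) : splitSum (X : ι → MvPolynomial ι ℝ) D = 0 := by
  induction hN : D.card using Nat.strong_induction_on generalizing D with
  | _ N ih =>
  subst hN
  rcases lt_or_ge D.card 3 with hlt | hge
  · have h3 : D.card = 0 ∨ D.card = 1 ∨ D.card = 2 := by omega
    rcases h3 with h | h | h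
    · rw [Finset.card_eq_zero] at h
      subst h
      simp [splitSum, splitWeight]
    · obtain ⟨a, rfl⟩ := Finset.card_eq_one.mp h
      rw [← insert_empty_eq, splitSum, Finset.sum_powerset_insert (by simp)]
      simp [splitWeight]
    · obtain ⟨a, b, hab, rfl⟩ := Finset.card_eq_two.mp h
      have e1 : ({b} : Finset ι) \ {a} = {b} := by grind
      have e2 : ({a, b} : Finset ι) \ {b} = {a} := by grind
      have e3 : ({b} : Finset ι) \ {a, b} = ∅ := by grind
      have hp : ∀ c : ι, pairProd (fun i j => (X j - X i : MvPolynomial ι ℝ) ^ 2) {c} = 1 := by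
        intro c
        rw [← insert_empty_eq, pairProd_insert (fun i j => by ring) (by simp)]
        simp
      have hp2 : pairProd (fun i j => (X j - X i : MvPolynomial ι ℝ) ^ 2) {a, b} =
          (X b - X a) ^ 2 := by
        rw [pairProd_insert (fun i j => by ring) (by simpa using hab), hp]
        simp
      rw [splitSum, Finset.sum_powerset_insert (by simpa using hab), ← insert_empty_eq b,
        Finset.sum_powerset_insert (by simp), Finset.sum_powerset_insert (by simp)]
      simp [splitWeight, splitTerm, e1, e2, e3, hab, hp, hp2]
      ring
  · by_contra hne
    have hdvd : pairProd (fun a b => (X b - X a : MvPolynomial ι ℝ) ^ 2) D ∣ splitSum X D := by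
      refine pairProd_X_sub_X_dvd fun a ha b hb hab => X_sub_X_sq_dvd hab.ne' ?_ ?_
      · rw [← AlgHom.coe_toRingHom, map_splitSum]
        have : ((rename (Equiv.swap b a) : MvPolynomial ι ℝ →ₐ[ℝ] MvPolynomial ι ℝ) :
            MvPolynomial ι ℝ →+* MvPolynomial ι ℝ) ∘ X
            = X ∘ Equiv.swap b a := by
          funext i; simp
        rw [this, splitSum_comp_equiv]
        congr 1
        ext i
        simp only [Finset.mem_image]
        constructor
        · rintro ⟨c, hc, rfl⟩
          rw [Equiv.swap_apply_def]
          split_ifs <;> assumption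
        · intro hi
          refine ⟨Equiv.swap b a i, ?_, Equiv.swap_apply_self _ _ _⟩
          rw [Equiv.swap_apply_def]
          split_ifs <;> assumption
      · obtain ⟨E, hE⟩ : ∃ E, E = (D.erase b).erase a := ⟨_, rfl⟩
        have hDE : D = insert a (insert b E) := by
          ext i; simp only [hE, Finset.mem_insert, Finset.mem_erase]; grind
        have haE : a ∉ E := by simp [hE]
        have hbE : b ∉ E := by simp [hE]
        have hcard : E.card < D.card := by
          rw [hDE, Finset.card_insert_of_notMem (by simp [hab.ne, haE]),
            Finset.card_insert_of_notMem hbE]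
          omega
        rw [← AlgHom.coe_toRingHom, map_splitSum, hDE,
          splitSum_insert_insert (by simp [hab.ne]) hab.ne haE hbE,
          ← map_splitSum, ih _ hcard E rfl, map_zero, mul_zero]
    obtain ⟨Q, hQ⟩ := hdvd
    have hQ0 : Q ≠ 0 := by
      rintro rfl
      exact hne (by rw [hQ, mul_zero])
    have := totalDegree_splitSum_lt hge
    rw [hQ, totalDegree_mul_of_isDomain (totalDegree_pairProd_sq D).2 hQ0,
      (totalDegree_pairProd_sq D).1] at this
    omega

/-- The polynomial identity for splittings, evaluated at real nodes. -/
theorem splitSum_eq_zero (x : ι → ℝ) (D : Finset ι) : splitSum x D = 0 := by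
  have h := map_splitSum (aeval x : MvPolynomial ι ℝ →ₐ[ℝ] ℝ).toRingHom X D
  rw [splitSum_X_eq_zero, map_zero] at h
  rw [h]
  congr 1
  funext i
  simp

end Degree

/-! ### The bilinear lattice -/

section Lattice

variable {ι : Type*} [LinearOrder ι]

/-- The coefficient `Δ_J² / Γ_J`, as a single product over the pairs in `J`. -/
noncomputable def pairCoeff (x : ι → ℝ) (J : Finset ι) : ℝ :=
  pairProd (fun i j => (x j - x i) ^ 2 / (x j + x i)) J

omit [LinearOrder ι] in
theorem pairCoeff_comm (x : ι → ℝ) (i j : ι) :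
    (x j - x i) ^ 2 / (x j + x i) = (x i - x j) ^ 2 / (x i + x j) := by
  rw [add_comm]; congr 1; ring

theorem pairCoeff_union (x : ι → ℝ) {J K : Finset ι} (h : Disjoint J K) :
    pairCoeff x (J ∪ K) = pairCoeff x J * pairCoeff x K *
      ∏ j ∈ J, ∏ k ∈ K, (x k - x j) ^ 2 / (x k + x j) :=
  pairProd_union (pairCoeff_comm x) h

theorem splitTerm_eq {x : ι → ℝ} (hx : ∀ i, 0 < x i) {J K : Finset ι} (h : Disjoint J K) :
    splitTerm x J K =
      pairProd (fun i j => x j + x i) (J ∪ K) * (pairCoeff x J * pairCoeff x K) := by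
  have key : ∀ J : Finset ι, pairProd (fun i j => (x j - x i) ^ 2) J =
      pairProd (fun i j => x j + x i) J * pairCoeff x J := by
    intro J
    rw [pairCoeff, ← pairProd_mul]
    refine pairProd_congr fun i _ j _ _ => ?_
    rw [mul_div_cancel₀]
    exact (add_pos (hx j) (hx i)).ne'
  rw [splitTerm, pairProd_union (fun i j => add_comm _ _) h, key, key]
  simp only [add_comm (x _) (x _)]
  ring

variable [Fintype ι]

/-- The sums over all pairs `(J, K)` vanish already when the intersection `C` and the symmetric
difference `D` are prescribed: up to a common factor they are the sums over splittings of `D`. -/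
theorem sum_splitWeight_mul_eq_zero {x : ι → ℝ} (hx : ∀ i, 0 < x i) (b : ι → ℝ) (k : ℤ) :
    ∑ p : Finset ι × Finset ι, (if (p.1.card + p.2.card : ℤ) = 2 * k then
      splitWeight x p.1 p.2 * (((∏ j ∈ p.1, b j) * pairCoeff x p.1) *
        ((∏ j ∈ p.2, b j) * pairCoeff x p.2)) else 0) = 0 := by
  rw [← Finset.sum_fiberwise Finset.univ
    (fun p : Finset ι × Finset ι => (p.1 ∩ p.2, p.1 \ p.2 ∪ p.2 \ p.1))]
  refine Finset.sum_eq_zero fun q _ => ?_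
  obtain ⟨C, D⟩ := q
  by_cases hCD : Disjoint C D
  swap
  · refine Finset.sum_eq_zero fun p hp => (hCD ?_).elim
    simp only [Finset.mem_filter, Finset.mem_univ, true_and, Prod.mk.injEq] at hp
    rw [← hp.1, ← hp.2, Finset.disjoint_left]
    intro i
    simp only [Finset.mem_inter, Finset.mem_union, Finset.mem_sdiff]
    tauto
  have hsum := splitSum_eq_zero x D
  -- The factor that all pairs with intersection `C` and symmetric difference `D` share.
  obtain ⟨m, hm⟩ : ∃ m, m = (if (2 * C.card + D.card : ℤ) = 2 * k then
      ((∏ j ∈ C, b j) * pairCoeff x C) ^ 2 * (∏ j ∈ D, b j) *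
        (∏ c ∈ C, ∏ d ∈ D, (x d - x c) ^ 2 / (x d + x c)) /
        pairProd (fun i j => x j + x i) D else 0) := ⟨_, rfl⟩
  refine Eq.trans (b := m * splitSum x D) ?_ (by rw [hsum, mul_zero])
  rw [splitSum, Finset.mul_sum]
  refine Finset.sum_nbij' (fun p => p.1 \ C) (fun J => (C ∪ J, C ∪ (D \ J))) ?_ ?_ ?_ ?_ ?_
  · rintro ⟨J, K⟩ hp
    simp only [Finset.mem_filter, Finset.mem_univ, true_and, Prod.mk.injEq] at hp
    obtain ⟨rfl, rfl⟩ := hp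
    rw [Finset.mem_powerset]
    intro i
    simp only [Finset.mem_inter, Finset.mem_union, Finset.mem_sdiff]
    tauto
  · intro J hJ
    rw [Finset.mem_powerset] at hJ
    simp only [Finset.mem_filter, Finset.mem_univ, true_and, Prod.mk.injEq]
    rw [Finset.disjoint_left] at hCD
    constructor <;> ext i <;> have h1 := @hCD i <;> have h2 := @hJ i <;>
      simp only [Finset.mem_inter, Finset.mem_union, Finset.mem_sdiff] <;> tauto
  · rintro ⟨J, K⟩ hp
    simp only [Finset.mem_filter, Finset.mem_univ, true_and, Prod.mk.injEq] at hp
    obtain ⟨rfl, rfl⟩ := hp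
    refine Prod.ext ?_ ?_ <;> ext i <;>
      simp only [Finset.mem_inter, Finset.mem_union, Finset.mem_sdiff] <;> tauto
  · intro J hJ
    rw [Finset.mem_powerset] at hJ
    rw [Finset.disjoint_left] at hCD
    ext i
    have h1 := @hCD i
    have h2 := @hJ i
    simp only [Finset.mem_union, Finset.mem_sdiff]
    tauto
  · rintro ⟨J', K'⟩ hp
    simp only [Finset.mem_filter, Finset.mem_univ, true_and, Prod.mk.injEq] at hp
    obtain ⟨J, hJ⟩ : ∃ J, J = J' \ C := ⟨_, rfl⟩
    have hJ' : J' = C ∪ J := by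
      rw [hJ, ← hp.1]
      ext i; simp only [Finset.mem_inter, Finset.mem_union, Finset.mem_sdiff]; tauto
    have hK' : K' = C ∪ (D \ J) := by
      rw [hJ, ← hp.1, ← hp.2]
      ext i; simp only [Finset.mem_inter, Finset.mem_union, Finset.mem_sdiff]; tauto
    have hJD : J ⊆ D := by
      rw [hJ, ← hp.1, ← hp.2]
      intro i; simp only [Finset.mem_inter, Finset.mem_union, Finset.mem_sdiff]; tauto
    have hd1 : Disjoint C J := hCD.mono_right hJD
    have hd2 : Disjoint C (D \ J) := hCD.mono_right Finset.sdiff_subset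
    have hd3 : Disjoint J (D \ J) := Finset.disjoint_sdiff
    have hu : J ∪ D \ J = D := Finset.union_sdiff_of_subset hJD
    change (if (J'.card + K'.card : ℤ) = 2 * k then _ else _) =
      m * (splitWeight x (J' \ C) (D \ (J' \ C)) * splitTerm x (J' \ C) (D \ (J' \ C)))
    rw [← hJ, hm, hJ', hK', splitTerm_eq hx hd3, hu]
    generalize hK : D \ J = K at hd2 hd3 hu
    have hΓ : pairProd (fun i j => x j + x i) D ≠ 0 :=
      Finset.prod_ne_zero_iff.mpr fun p _ => (add_pos (hx _) (hx _)).ne'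
    have hcard : ((C ∪ J).card + (C ∪ K).card : ℤ) = 2 * C.card + D.card := by
      rw [← hu, Finset.card_union_of_disjoint hd1, Finset.card_union_of_disjoint hd2,
        Finset.card_union_of_disjoint hd3]
      push_cast; ring
    have hw : splitWeight x (C ∪ J) (C ∪ K) = splitWeight x J K := by
      simp only [splitWeight, Finset.card_union_of_disjoint hd1,
        Finset.card_union_of_disjoint hd2, Finset.sum_union hd1, Finset.sum_union hd2,
        add_sub_add_left_eq_sub, add_assoc, Nat.add_left_cancel_iff]
    rw [hcard, hw]
    split_ifs with hk
    · rw [pairCoeff_union x hd1, pairCoeff_union x hd2, Finset.prod_union hd1,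
        Finset.prod_union hd2]
      have e1 : (∏ j ∈ D, b j) = (∏ j ∈ J, b j) * ∏ j ∈ K, b j := by
        rw [← hu, Finset.prod_union hd3]
      have e2 : (∏ c ∈ C, ∏ d ∈ D, (x d - x c) ^ 2 / (x d + x c)) =
          (∏ c ∈ C, ∏ d ∈ J, (x d - x c) ^ 2 / (x d + x c)) *
            ∏ c ∈ C, ∏ d ∈ K, (x d - x c) ^ 2 / (x d + x c) := by
        rw [← hu, ← Finset.prod_mul_distrib]
        exact Finset.prod_congr rfl fun c _ => Finset.prod_union hd3
      rw [e1, e2]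
      generalize pairProd (fun i j => x j + x i) D = Γ at hΓ
      rw [show ∀ u v w y c₁ c₂ c₃ g₁ g₂ : ℝ,
        w * (u * v * (c₁ * c₂ * g₁) * (u * y * (c₁ * c₃ * g₂))) =
          (u * c₁) ^ 2 * (v * y) * (g₁ * g₂) / Γ * (w * (Γ * (c₂ * c₃))) from
        fun u v w y c₁ c₂ c₃ g₁ g₂ => by field_simp]
    · rw [zero_mul]

/-- The power sums `∑_{|J| = k} s_J ^ r b_J Δ_J² / Γ_J`, where `s_J` is the sum of the nodes in
`J`. These are the `r`-th derivatives of `τ_k`. -/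
noncomputable def tauMoment (x b : ι → ℝ) (r : ℕ) (k : ℤ) : ℝ :=
  ∑ J : Finset ι, if (J.card : ℤ) = k then
    (∑ j ∈ J, x j) ^ r * ((∏ j ∈ J, b j) * pairCoeff x J) else 0

/-- Expanding both sides over pairs `(J, K)` and symmetrizing the left side in `J` and `K` gives
half the weights `splitWeight`. -/
theorem tauMoment_bilinear {x : ι → ℝ} (hx : ∀ i, 0 < x i) (b : ι → ℝ) (k : ℤ) :
    tauMoment x b 2 k * tauMoment x b 0 k - tauMoment x b 1 k ^ 2 =
      tauMoment x b 0 (k - 1) * tauMoment x b 1 (k + 1) -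
        tauMoment x b 1 (k - 1) * tauMoment x b 0 (k + 1) := by
  have h := sum_splitWeight_mul_eq_zero hx b k
  rw [Fintype.sum_prod_type] at h
  obtain ⟨a, ha⟩ : ∃ a : ℕ → ℤ → Finset ι → ℝ, a = fun r k J => if (J.card : ℤ) = k then
    (∑ j ∈ J, x j) ^ r * ((∏ j ∈ J, b j) * pairCoeff x J) else 0 := ⟨_, rfl⟩
  have hT : ∀ r k, tauMoment x b r k = ∑ J, a r k J := fun r k => by rw [ha]; rfl
  have hpt : ∀ J K : Finset ι, (if (J.card + K.card : ℤ) = 2 * k then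
      splitWeight x J K * (((∏ j ∈ J, b j) * pairCoeff x J) *
        ((∏ j ∈ K, b j) * pairCoeff x K)) else 0) =
      a 2 k J * a 0 k K + a 0 k J * a 2 k K - 2 * (a 1 k J * a 1 k K) -
        2 * (a 1 (k + 1) J * a 0 (k - 1) K - a 0 (k + 1) J * a 1 (k - 1) K) := by
    intro J K
    have c1 : J.card = K.card ↔ (J.card : ℤ) = K.card := by omega
    have c2 : J.card = K.card + 2 ↔ (J.card : ℤ) = K.card + 2 := by omega
    simp only [ha, splitWeight, c1, c2]
    generalize (J.card : ℤ) = p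
    generalize (K.card : ℤ) = q
    by_cases h1 : p = k
    · by_cases h2 : q = k
      · subst h1 h2
        simp [two_mul]
        ring
      · have : ¬ p + q = 2 * k := by omega
        have h3 : ¬ p = k + 1 := by omega
        simp [this, h2, h3]
    · by_cases h2 : p = k + 1
      · by_cases h3 : q = k - 1
        · subst h2 h3
          have e1 : k + 1 + (k - 1) = 2 * k := by ring
          have e2 : ¬ k + 1 = k - 1 := by omega
          have e3 : k + 1 = k - 1 + 2 := by ring
          rw [if_pos e1, if_neg e2, if_pos e3]
          simp
          ring
        · have : ¬ p + q = 2 * k := by omega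
          simp [this, h1, h3]
      · by_cases h3 : p + q = 2 * k
        · have h4 : ¬ p = q := by omega
          have h5 : ¬ p = q + 2 := by omega
          simp [h1, h2, h4, h5]
        · simp [h1, h2, h3]
  simp only [hpt, Finset.sum_add_distrib, Finset.sum_sub_distrib, ← Finset.mul_sum,
    ← Finset.sum_mul, ← hT] at h
  linear_combination h / 2

end Lattice

section Derivatives

variable {n : ℕ} {ζ : Fin n → ℝ} {b : Fin n → ℝ → ℝ}

theorem tau_eq_tauMoment (ζ : Fin n → ℝ) (b : Fin n → ℝ → ℝ) (k : ℤ) (t : ℝ) :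
    tau ζ b k t = tauMoment ζ (fun j => b j t) 0 k := by
  rw [tau, Finset.sum_filter, tauMoment]
  refine Finset.sum_congr rfl fun J _ => if_congr Iff.rfl ?_ rfl
  rw [pow_zero, one_mul, mul_div_assoc, pairCoeff, pairProd, Finset.prod_div_distrib,
    Finset.prod_pow]
  rfl

theorem hasDerivAt_prod_flow (hb : ∀ j t, HasDerivAt (b j) (ζ j * b j t) t) (J : Finset (Fin n))
    (t : ℝ) : HasDerivAt (fun t => ∏ j ∈ J, b j t) ((∑ j ∈ J, ζ j) * ∏ j ∈ J, b j t) t := by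
  induction J using Finset.induction_on with
  | empty => simpa using hasDerivAt_const t (1 : ℝ)
  | insert a J ha ih =>
    simp only [Finset.prod_insert ha, Finset.sum_insert ha]
    exact ((hb a t).mul ih).congr_deriv (by ring)

theorem hasDerivAt_tauMoment (hb : ∀ j t, HasDerivAt (b j) (ζ j * b j t) t) (r : ℕ) (k : ℤ)
    (t : ℝ) : HasDerivAt (fun t => tauMoment ζ (fun j => b j t) r k)
      (tauMoment ζ (fun j => b j t) (r + 1) k) t := by
  refine HasDerivAt.fun_sum fun J _ => ?_
  split_ifs
  · exact (((hasDerivAt_prod_flow hb J t).mul_const (pairCoeff ζ J)).const_mul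
      ((∑ j ∈ J, ζ j) ^ r)).congr_deriv (by ring)
  · exact hasDerivAt_const t 0

theorem deriv_tau (hb : ∀ j t, HasDerivAt (b j) (ζ j * b j t) t) (k : ℤ) :
    deriv (tau ζ b k) = fun t => tauMoment ζ (fun j => b j t) 1 k := by
  rw [funext (tau_eq_tauMoment ζ b k)]
  exact funext fun t => (hasDerivAt_tauMoment hb 0 k t).deriv

theorem deriv_deriv_tau (hb : ∀ j t, HasDerivAt (b j) (ζ j * b j t) t) (k : ℤ) :
    deriv (deriv (tau ζ b k)) = fun t => tauMoment ζ (fun j => b j t) 2 k := by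
  rw [deriv_tau hb]
  exact funext fun t => (hasDerivAt_tauMoment hb 1 k t).deriv

theorem flow_eq_exp (hb : ∀ j t, HasDerivAt (b j) (ζ j * b j t) t) (j : Fin n) :
    b j = fun t => b j 0 * Real.exp (ζ j * t) := by
  funext t
  have hd : ∀ s, HasDerivAt (fun s => b j s * Real.exp (-(ζ j * s))) 0 s := by
    intro s
    have h2 : HasDerivAt (fun s => Real.exp (-(ζ j * s))) (Real.exp (-(ζ j * s)) * -(ζ j * 1)) s :=
      (((hasDerivAt_id s).const_mul (ζ j)).neg).exp
    exact ((hb j s).mul h2).congr_deriv (by ring)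
  have hc := is_const_of_deriv_eq_zero (fun s => (hd s).differentiableAt)
    (fun s => (hd s).deriv) t 0
  simp only [mul_zero, neg_zero, Real.exp_zero, mul_one] at hc
  rw [← hc, mul_assoc, ← Real.exp_add, neg_add_cancel, Real.exp_zero, mul_one]

theorem contDiff_tau (hb : ∀ j t, HasDerivAt (b j) (ζ j * b j t) t) (k : ℤ) :
    ContDiff ℝ 2 (tau ζ b k) := by
  have h : ∀ j, ContDiff ℝ 2 (b j) := fun j => by
    rw [flow_eq_exp hb j]; fun_prop
  unfold tau
  refine ContDiff.sum fun J _ => ContDiff.div_const (ContDiff.mul ?_ contDiff_const) _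
  exact contDiff_prod fun j _ => h j

end Derivatives

/-! ### Pairings and the group of block permutations -/

section Pairings

variable {N : ℕ}

/-- The positions `0, …, 2N - 1`, arranged in `N` consecutive blocks of two. -/
def pos (N : ℕ) : Fin N × Fin 2 ≃ Fin (2 * N) where
  toFun p := ⟨2 * p.1 + p.2, by omega⟩
  invFun i := (⟨i / 2, by omega⟩, ⟨i % 2, by omega⟩)
  left_inv p := by
    obtain ⟨⟨l, hl⟩, ⟨e, he⟩⟩ := p
    simp only [Prod.mk.injEq, Fin.mk.injEq]
    omega
  right_inv i := by
    ext
    simp only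
    omega

/-- The permutation that permutes the blocks by `π` and then permutes each block by `ε`. -/
def blockPerm (h : Equiv.Perm (Fin N) × (Fin N → Equiv.Perm (Fin 2))) :
    Equiv.Perm (Fin (2 * N)) :=
  (pos N).permCongr (Equiv.prodCongrRight h.2 * Equiv.prodCongrLeft fun _ => h.1)

theorem blockPerm_pos (h : Equiv.Perm (Fin N) × (Fin N → Equiv.Perm (Fin 2))) (l : Fin N)
    (e : Fin 2) : blockPerm h (pos N (l, e)) = pos N (h.1 l, h.2 (h.1 l) e) := by
  simp [blockPerm, Equiv.permCongr_apply]

theorem sign_blockPerm (h : Equiv.Perm (Fin N) × (Fin N → Equiv.Perm (Fin 2))) :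
    Equiv.Perm.sign (blockPerm h) = ∏ l, Equiv.Perm.sign (h.2 l) := by
  rw [blockPerm, Equiv.Perm.sign_permCongr, Equiv.Perm.sign_mul, Equiv.Perm.sign_prodCongrRight,
    Equiv.Perm.sign_prodCongrLeft]
  simp

theorem perm_fin_two (ε : Equiv.Perm (Fin 2)) : ε = 1 ∨ ε = Equiv.swap 0 1 := by
  revert ε; decide

theorem isPairing_iff (σ : Equiv.Perm (Fin (2 * N))) :
    IsPairing σ ↔ (∀ l, σ (pos N (l, 0)) < σ (pos N (l, 1))) ∧
      StrictMono fun l => σ (pos N (l, 0)) :=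
  Iff.rfl

/-- Every permutation can be brought into the standard form of a pairing by exactly one
permutation of the blocks and of the positions inside the blocks. -/
theorem existsUnique_isPairing_mul_blockPerm (σ : Equiv.Perm (Fin (2 * N))) :
    ∃! h, IsPairing (σ * blockPerm (N := N) h) := by
  -- The swaps `ε` make each pair increasing; the blocks are then sorted by their first values `g`.
  let ε : Fin N → Equiv.Perm (Fin 2) := fun l =>
    if σ (pos N (l, 0)) < σ (pos N (l, 1)) then 1 else Equiv.swap 0 1
  have hε : ∀ l, σ (pos N (l, ε l 0)) < σ (pos N (l, ε l 1)) := by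
    intro l
    simp only [ε]
    split_ifs with h
    · exact h
    · have hne : σ (pos N (l, 1)) ≠ σ (pos N (l, 0)) := by simp
      simpa using lt_of_le_of_ne (not_lt.mp h) hne
  let g : Fin N → Fin (2 * N) := fun l => σ (pos N (l, ε l 0))
  have hg : Function.Injective g := by
    intro l m hlm
    simpa using congrArg Prod.fst ((pos N).injective (σ.injective hlm))
  refine ⟨(Tuple.sort g, ε), ?_, ?_⟩
  · simp only [isPairing_iff, Equiv.Perm.mul_apply, blockPerm_pos]
    exact ⟨fun l => hε _,
      (Tuple.monotone_sort g).strictMono_of_injective (hg.comp (Tuple.sort g).injective)⟩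
  · rintro ⟨π', ε'⟩ h
    simp only [isPairing_iff, Equiv.Perm.mul_apply, blockPerm_pos] at h
    have hε' : ε' = ε := by
      funext l
      have h1 := h.1 (π'.symm l)
      rw [Equiv.apply_symm_apply] at h1
      have h2 := hε l
      rcases perm_fin_two (ε' l) with h3 | h3 <;> rcases perm_fin_two (ε l) with h4 | h4 <;>
        rw [h3] at h1 ⊢ <;> rw [h4] at h2 ⊢ <;> simp at h1 h2 <;>
        exact (lt_asymm h1 h2).elim
    subst hε'
    have hm : Monotone (g ∘ π') := h.2.monotone
    have := Tuple.unique_monotone hm (Tuple.monotone_sort g)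
    refine Prod.ext (Equiv.ext fun l => hg (congrFun this l)) rfl

/-- The number of block permutations, `2 ^ N * N!`. -/
noncomputable def blockCard (N : ℕ) : ℝ :=
  Fintype.card (Equiv.Perm (Fin N) × (Fin N → Equiv.Perm (Fin 2)))

theorem blockCard_ne_zero (N : ℕ) : blockCard N ≠ 0 :=
  Nat.cast_ne_zero.mpr Fintype.card_ne_zero

open Classical in
theorem sum_perm_eq_blockCard_mul {F : Equiv.Perm (Fin (2 * N)) → ℝ}
    (hF : ∀ σ h, F (σ * blockPerm h) = F σ) :
    ∑ σ, F σ = blockCard N * ∑ σ : Equiv.Perm (Fin (2 * N)) with IsPairing σ, F σ := by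
  have h1 : ∀ σ : Equiv.Perm (Fin (2 * N)), F σ = ∑ h, if IsPairing (σ * blockPerm (N := N) h)
      then F (σ * blockPerm h) else 0 := by
    intro σ
    obtain ⟨h, hh, hu⟩ := existsUnique_isPairing_mul_blockPerm σ
    rw [Finset.sum_eq_single h]
    · rw [if_pos hh, hF]
    · intro h' _ hne
      exact if_neg fun hp => hne (hu _ hp)
    · simp
  rw [Finset.sum_congr rfl fun σ _ => h1 σ, Finset.sum_comm]
  have h2 : ∀ h : Equiv.Perm (Fin N) × (Fin N → Equiv.Perm (Fin 2)),
      (∑ σ : Equiv.Perm (Fin (2 * N)), if IsPairing (σ * blockPerm h)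
        then F (σ * blockPerm h) else 0) =
      ∑ σ : Equiv.Perm (Fin (2 * N)) with IsPairing σ, F σ := by
    intro h
    rw [Finset.sum_filter]
    exact Equiv.sum_comp (Equiv.mulRight (blockPerm h)) fun σ => if IsPairing σ then F σ else 0
  rw [Finset.sum_congr rfl fun h _ => h2 h, Finset.sum_const, nsmul_eq_mul, blockCard,
    Finset.card_univ]

/-- For an antisymmetric matrix the product over the blocks changes under a block permutation by
its sign: only the swaps inside the blocks matter. -/
theorem prod_blockPerm {κ R : Type*} [CommRing R] {A : κ → κ → R} (hA : ∀ i j, A i j = -A j i)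
    (f : Fin (2 * N) → κ) (h : Equiv.Perm (Fin N) × (Fin N → Equiv.Perm (Fin 2))) :
    ∏ l, A (f (blockPerm h (pos N (l, 0)))) (f (blockPerm h (pos N (l, 1)))) =
      ((Equiv.Perm.sign (blockPerm h) : ℤ) : R) *
        ∏ l, A (f (pos N (l, 0))) (f (pos N (l, 1))) := by
  simp only [blockPerm_pos]
  rw [Equiv.prod_comp h.1 fun l => A (f (pos N (l, h.2 l 0))) (f (pos N (l, h.2 l 1))),
    sign_blockPerm]
  push_cast
  rw [← Finset.prod_mul_distrib]
  refine Finset.prod_congr rfl fun l _ => ?_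
  rcases perm_fin_two (h.2 l) with h3 | h3 <;> rw [h3]
  · simp
  · rw [hA]; simp

theorem sign_mul_sign {α R : Type*} [DecidableEq α] [Fintype α] [CommRing R] (σ : Equiv.Perm α) :
    ((Equiv.Perm.sign σ : ℤ) : R) * ((Equiv.Perm.sign σ : ℤ) : R) = 1 := by
  rw [← Int.cast_mul, ← Units.val_mul, Int.units_mul_self]; simp

/-- The sum over all permutations counts every pairing once for each block permutation. -/
theorem sum_perm_eq_pfaffian {A : Matrix (Fin (2 * N)) (Fin (2 * N)) ℝ}
    (hA : ∀ i j, A i j = -A j i) :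
    ∑ σ : Equiv.Perm (Fin (2 * N)), ((Equiv.Perm.sign σ : ℤ) : ℝ) *
      ∏ l, A (σ (pos N (l, 0))) (σ (pos N (l, 1))) = blockCard N * pfaffian A := by
  rw [sum_perm_eq_blockCard_mul]
  · rfl
  · intro σ h
    simp only [Equiv.Perm.mul_apply]
    rw [prod_blockPerm hA σ, Equiv.Perm.sign_mul]
    push_cast
    linear_combination (((Equiv.Perm.sign σ : ℤ) : ℝ) *
      ∏ l, A (σ (pos N (l, 0))) (σ (pos N (l, 1)))) * sign_mul_sign (R := ℝ) (blockPerm h)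

end Pairings

/-! ### Schur's Pfaffian -/

section Schur

variable {N : ℕ} {R S : Type*} [CommRing R] [CommRing S]

/-- The block that contains the position `i`. -/
def blk (i : Fin (2 * N)) : Fin N := ((pos N).symm i).1

@[simp]
theorem blk_pos (l : Fin N) (e : Fin 2) : blk (pos N (l, e)) = l := by
  simp [blk]

theorem blk_val (i : Fin (2 * N)) : (blk i : ℕ) = i / 2 := rfl

theorem pos_lt_pos_iff (l m : Fin N) (e f : Fin 2) :
    pos N (l, e) < pos N (m, f) ↔ l < m ∨ (l = m ∧ e < f) := by
  simp only [pos, Equiv.coe_fn_mk, Fin.lt_def, Fin.ext_iff]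
  omega

theorem exists_pos (i : Fin (2 * N)) : ∃ l e, i = pos N (l, e) :=
  ⟨_, _, ((pos N).apply_symm_apply i).symm⟩

theorem pairProd_ite_blk (g : Fin (2 * N) → Fin (2 * N) → R) :
    pairProd (fun i j => if blk i = blk j then g i j else 1) Finset.univ =
      ∏ l, g (pos N (l, 0)) (pos N (l, 1)) := by
  rw [pairProd_eq, ← Equiv.prod_comp (pos N), Fintype.prod_prod_type]
  refine Finset.prod_congr rfl fun l _ => ?_
  rw [Fin.prod_univ_two, ← Equiv.prod_comp (pos N), ← Equiv.prod_comp (pos N),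
    Fintype.prod_prod_type, Fintype.prod_prod_type, Finset.prod_eq_single l,
    Finset.prod_eq_single l]
  · simp [pos_lt_pos_iff]
  all_goals simp +contextual [pos_lt_pos_iff, eq_comm]

/-- The product of `x_j - x_i` over the pairs of positions that form a block, times the product
of `x_j + x_i` over all other pairs. -/
def blockNumer (x : Fin (2 * N) → R) : R :=
  pairProd (fun i j => if blk i = blk j then x j - x i else x j + x i) Finset.univ

theorem map_blockNumer (φ : R →+* S) (x : Fin (2 * N) → R) :
    φ (blockNumer x) = blockNumer (φ ∘ x) := by
  rw [blockNumer, blockNumer, map_pairProd]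
  refine pairProd_congr fun i _ j _ _ => ?_
  split_ifs <;> simp

theorem blockNumer_eq (x : Fin (2 * N) → R) :
    blockNumer x = (∏ l, (x (pos N (l, 1)) - x (pos N (l, 0)))) *
      pairProd (fun i j => if blk i = blk j then 1 else x j + x i) Finset.univ := by
  rw [← pairProd_ite_blk fun i j => x j - x i, ← pairProd_mul]
  refine pairProd_congr fun i _ j _ _ => ?_
  split_ifs <;> simp

theorem pairProd_comp_perm {ι : Type*} [LinearOrder ι] [Fintype ι] {g : ι → ι → R}
    (hg : ∀ i j, g i j = g j i) (σ : Equiv.Perm ι) :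
    pairProd (fun i j => g (σ i) (σ j)) Finset.univ = pairProd g Finset.univ := by
  rw [← pairProd_image hg σ.injective, Finset.image_univ_equiv]

theorem blk_blockPerm (h : Equiv.Perm (Fin N) × (Fin N → Equiv.Perm (Fin 2)))
    (i : Fin (2 * N)) : blk (blockPerm h i) = h.1 (blk i) := by
  obtain ⟨l, e, rfl⟩ := exists_pos i
  rw [blockPerm_pos, blk_pos, blk_pos]

theorem blockNumer_comp_blockPerm (x : Fin (2 * N) → R)
    (h : Equiv.Perm (Fin N) × (Fin N → Equiv.Perm (Fin 2))) :
    blockNumer (x ∘ blockPerm h) = ((Equiv.Perm.sign (blockPerm h) : ℤ) : R) * blockNumer x := by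
  rw [blockNumer_eq, blockNumer_eq, ← mul_assoc]
  congr 1
  · exact prod_blockPerm (A := fun a b => b - a) (fun i j => by ring) x h
  · rw [← pairProd_comp_perm (g := fun i j => if blk i = blk j then 1 else x j + x i)
      (fun i j => by simp only [eq_comm, add_comm]) (blockPerm h)]
    simp only [blk_blockPerm, h.1.injective.eq_iff, Function.comp_apply]

/-- The antisymmetrization of `blockNumer`: Schur's Pfaffian with its denominators cleared, up to
the number of block permutations. -/
def altNumer (x : Fin (2 * N) → R) : R :=
  ∑ σ : Equiv.Perm (Fin (2 * N)), ((Equiv.Perm.sign σ : ℤ) : R) * blockNumer (x ∘ σ)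

theorem map_altNumer (φ : R →+* S) (x : Fin (2 * N) → R) :
    φ (altNumer x) = altNumer (φ ∘ x) := by
  simp [altNumer, map_blockNumer, Function.comp_assoc]

theorem altNumer_comp_perm (x : Fin (2 * N) → R) (τ : Equiv.Perm (Fin (2 * N))) :
    altNumer (x ∘ τ) = ((Equiv.Perm.sign τ : ℤ) : R) * altNumer x := by
  rw [altNumer, altNumer, Finset.mul_sum, ← Equiv.sum_comp (Equiv.mulLeft τ)
    fun σ => ((Equiv.Perm.sign τ : ℤ) : R) * (((Equiv.Perm.sign σ : ℤ) : R) * blockNumer (x ∘ σ))]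
  refine Finset.sum_congr rfl fun σ _ => ?_
  rw [Equiv.coe_mulLeft, Equiv.Perm.sign_mul, Function.comp_assoc, Equiv.Perm.coe_mul]
  push_cast
  linear_combination (-((Equiv.Perm.sign σ : ℤ) : R) * blockNumer (x ∘ τ ∘ σ)) *
    sign_mul_sign (R := R) τ

open MvPolynomial in
/-- An antisymmetric polynomial is divisible by the Vandermonde product, and here both have the
same degree. -/
theorem exists_altNumer_eq (N : ℕ) : ∃ c : ℝ, ∀ x : Fin (2 * N) → ℝ,
    altNumer x = c * pairProd (fun i j => x j - x i) Finset.univ := by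
  let P : MvPolynomial (Fin (2 * N)) ℝ := altNumer X
  let V : MvPolynomial (Fin (2 * N)) ℝ := pairProd (fun i j => X j - X i) Finset.univ
  let s : Finset (Fin (2 * N) × Fin (2 * N)) :=
    {p ∈ Finset.univ ×ˢ Finset.univ | p.1 < p.2}
  have hV0 : V ≠ 0 := Finset.prod_ne_zero_iff.mpr fun p hp => by
    simp only [Finset.mem_filter] at hp
    exact sub_ne_zero.mpr fun h => hp.2.ne' (X_injective h)
  have hVdeg : V.totalDegree = s.card := totalDegree_prod_eq_card fun p hp => by
    simp only [Finset.mem_filter] at hp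
    exact totalDegree_X_sub_X hp.2.ne'
  have hPdeg : P.totalDegree ≤ s.card := by
    refine totalDegree_finsetSum_le fun σ _ => ?_
    rw [← zsmul_eq_mul]
    refine (totalDegree_smul_le _ _).trans ?_
    refine (totalDegree_finsetProd _ _).trans ?_
    refine (Finset.sum_le_card_nsmul _ _ 1 fun p _ => ?_).trans (by simp [s])
    dsimp only
    split_ifs
    · exact (totalDegree_sub _ _).trans (by simp)
    · exact (totalDegree_add _ _).trans (by simp)
  have hdvd : V ∣ P := by
    have h1 : pairProd (fun a b => (X b - X a : MvPolynomial (Fin (2 * N)) ℝ) ^ 1)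
        Finset.univ ∣ P := by
      refine pairProd_X_sub_X_dvd fun a _ b _ hab => ?_
      rw [pow_one]
      apply X_sub_X_dvd_of_rename_swap_eq_neg
      have h2 := map_altNumer ((rename (Equiv.swap b a) :
        MvPolynomial (Fin (2 * N)) ℝ →ₐ[ℝ] MvPolynomial (Fin (2 * N)) ℝ) :
        MvPolynomial (Fin (2 * N)) ℝ →+* MvPolynomial (Fin (2 * N)) ℝ) X
      have h3 : ((rename (Equiv.swap b a) :
        MvPolynomial (Fin (2 * N)) ℝ →ₐ[ℝ] MvPolynomial (Fin (2 * N)) ℝ) :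
        MvPolynomial (Fin (2 * N)) ℝ →+* MvPolynomial (Fin (2 * N)) ℝ) ∘ X =
          X ∘ Equiv.swap b a := by
        funext i; simp
      rw [h3, altNumer_comp_perm, Equiv.Perm.sign_swap hab.ne'] at h2
      simpa using h2
    simpa only [pow_one] using h1
  obtain ⟨Q, hQ⟩ := hdvd
  have hQdeg : Q.totalDegree = 0 := by
    by_cases hQ0 : Q = 0
    · rw [hQ0, totalDegree_zero]
    · have h1 := congrArg totalDegree hQ
      rw [totalDegree_mul_of_isDomain hV0 hQ0] at h1
      omega
  rw [totalDegree_eq_zero_iff_eq_C] at hQdeg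
  refine ⟨coeff 0 Q, fun x => ?_⟩
  have h1 := map_altNumer ((aeval x : MvPolynomial (Fin (2 * N)) ℝ →ₐ[ℝ] ℝ) :
    MvPolynomial (Fin (2 * N)) ℝ →+* ℝ) X
  have h2 : ((aeval x : MvPolynomial (Fin (2 * N)) ℝ →ₐ[ℝ] ℝ) :
    MvPolynomial (Fin (2 * N)) ℝ →+* ℝ) ∘ X = x := by
    funext i; simp
  rw [h2] at h1
  rw [← h1]
  change aeval x P = _
  rw [hQ, hQdeg, map_mul, aeval_C, coeff_C, if_pos rfl, mul_comm, map_pairProd]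
  simp

/-- The other position in the block of `i`. -/
def mate (N : ℕ) : Equiv.Perm (Fin (2 * N)) := blockPerm (1, fun _ => Equiv.swap 0 1)

theorem mate_pos_zero (l : Fin N) : mate N (pos N (l, 0)) = pos N (l, 1) := by
  simp [mate, blockPerm_pos]

theorem mate_pos_one (l : Fin N) : mate N (pos N (l, 1)) = pos N (l, 0) := by
  simp [mate, blockPerm_pos]

theorem blk_mate (i : Fin (2 * N)) : blk (mate N i) = blk i := by
  simp [mate, blk_blockPerm]

theorem lt_iff_blk_lt {i j : Fin (2 * N)} (h : blk i ≠ blk j) : i < j ↔ blk i < blk j := by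
  rw [ne_eq, Fin.ext_iff, blk_val, blk_val] at h
  rw [Fin.lt_def, Fin.lt_def, blk_val, blk_val]
  omega

/-- The nodes `-1, 1, -2, 2, …`, which make `x_i + x_j` vanish exactly when `i` and `j` form a
block. -/
def oppositeNodes (N : ℕ) (i : Fin (2 * N)) : ℝ :=
  if ((pos N).symm i).2 = 0 then -((blk i : ℕ) + 1 : ℝ) else (blk i : ℕ) + 1

theorem oppositeNodes_mate (i : Fin (2 * N)) :
    oppositeNodes N (mate N i) = -oppositeNodes N i := by
  obtain ⟨l, e, rfl⟩ := exists_pos i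
  have he : e = 0 ∨ e = 1 := by omega
  rcases he with rfl | rfl
  · rw [mate_pos_zero]; simp [oppositeNodes]
  · rw [mate_pos_one]; simp [oppositeNodes]

theorem oppositeNodes_sq (i : Fin (2 * N)) : oppositeNodes N i ^ 2 = ((blk i : ℕ) + 1 : ℝ) ^ 2 := by
  rw [oppositeNodes]
  split_ifs <;> ring

theorem blk_eq_of_oppositeNodes_sq {i j : Fin (2 * N)}
    (h : oppositeNodes N i ^ 2 = oppositeNodes N j ^ 2) : blk i = blk j := by
  rw [oppositeNodes_sq, oppositeNodes_sq, sq_eq_sq₀ (by positivity) (by positivity),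
    add_left_inj, Nat.cast_inj] at h
  exact Fin.ext h

theorem pairProd_oppositeNodes :
    pairProd (fun i j => oppositeNodes N j - oppositeNodes N i) Finset.univ =
      blockNumer (oppositeNodes N) := by
  -- Replacing `i` by its mate changes the sign of its node and keeps the order of `i` and `j`.
  have h1 : pairProd (fun i j => if blk i = blk j then 1 else
      oppositeNodes N j - oppositeNodes N i) Finset.univ =
      pairProd (fun i j => if blk i = blk j then 1 else
        oppositeNodes N j + oppositeNodes N i) Finset.univ := by
    rw [pairProd_eq, pairProd_eq, ← Equiv.prod_comp (mate N)]
    refine Finset.prod_congr rfl fun i _ => Finset.prod_congr rfl fun j _ => ?_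
    rw [blk_mate, oppositeNodes_mate]
    by_cases hb : blk i = blk j
    · simp [hb]
    · have hlt : mate N i < j ↔ i < j := by
        rw [lt_iff_blk_lt hb, lt_iff_blk_lt (by rwa [blk_mate]), blk_mate]
      simp [hb, hlt]
  rw [blockNumer_eq, ← h1, ← pairProd_ite_blk fun i j => oppositeNodes N j - oppositeNodes N i,
    ← pairProd_mul]
  refine pairProd_congr fun i _ j _ _ => ?_
  split_ifs <;> simp

theorem blockNumer_oppositeNodes_ne_zero : blockNumer (oppositeNodes N) ≠ 0 := by
  rw [← pairProd_oppositeNodes]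
  refine Finset.prod_ne_zero_iff.mpr fun p hp => ?_
  simp only [Finset.mem_filter] at hp
  intro h
  change oppositeNodes N p.2 - oppositeNodes N p.1 = 0 at h
  have hb := blk_eq_of_oppositeNodes_sq (congrArg (· ^ 2) (sub_eq_zero.mp h))
  obtain ⟨l, e, h1⟩ := exists_pos p.1
  obtain ⟨m, f, h2⟩ := exists_pos p.2
  rw [h1, h2, blk_pos, blk_pos] at hb
  rw [h1, h2, pos_lt_pos_iff] at hp
  have he : e = 0 ∧ f = 1 := by omega
  rw [h1, h2, hb, he.1, he.2, ← mate_pos_zero, oppositeNodes_mate, sub_eq_zero,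
    neg_eq_iff_add_eq_zero,
    ← two_mul] at h
  have h3 := (mul_eq_zero.mp h).resolve_left two_ne_zero
  have h4 := oppositeNodes_sq (pos N (l, 0))
  rw [h3] at h4
  have : (0 : ℝ) < ((blk (pos N (l, 0)) : ℕ) + 1 : ℝ) ^ 2 := by positivity
  linarith

theorem isPairing_one : IsPairing (1 : Equiv.Perm (Fin (2 * N))) := by
  rw [isPairing_iff]
  refine ⟨fun l => ?_, fun l m h => ?_⟩
  · simp [pos_lt_pos_iff]
  · simp [pos_lt_pos_iff, h]

/-- At the opposite nodes, a nonzero term must keep the blocks together, and the only pairing in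
standard form that does so is the identity. -/
theorem eq_one_of_isPairing {σ : Equiv.Perm (Fin (2 * N))} (hσ : IsPairing σ)
    (h : blockNumer (oppositeNodes N ∘ σ) ≠ 0) : σ = 1 := by
  rw [isPairing_iff] at hσ
  have hne : ∀ i j, blk i ≠ blk j → oppositeNodes N (σ j) + oppositeNodes N (σ i) ≠ 0 := by
    have key : ∀ i j, i < j → blk i ≠ blk j →
        oppositeNodes N (σ j) + oppositeNodes N (σ i) ≠ 0 := by
      intro i j hij hb
      have h1 := Finset.prod_ne_zero_iff.mp h (i, j) (by simpa using hij)
      simpa only [if_neg hb, Function.comp_apply] using h1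
    intro i j hb
    rcases lt_trichotomy i j with hij | rfl | hij
    · exact key i j hij hb
    · exact (hb rfl).elim
    · rw [add_comm]
      exact key j i hij hb.symm
  have hmate : ∀ l, σ (pos N (l, 1)) = mate N (σ (pos N (l, 0))) := by
    intro l
    have h1 : blk (pos N (l, 0)) = blk (σ.symm (mate N (σ (pos N (l, 0))))) := by
      by_contra hb
      apply hne _ _ hb
      rw [Equiv.apply_symm_apply, oppositeNodes_mate, neg_add_cancel]
    obtain ⟨m, e, h2⟩ := exists_pos (σ.symm (mate N (σ (pos N (l, 0)))))
    rw [h2, blk_pos, blk_pos] at h1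
    subst h1
    have he : e = 0 ∨ e = 1 := by omega
    rcases he with rfl | rfl
    · exfalso
      rw [Equiv.symm_apply_eq] at h2
      obtain ⟨m, f, h3⟩ := exists_pos (σ (pos N (l, 0)))
      rw [h3] at h2
      have hf : f = 0 ∨ f = 1 := by omega
      rcases hf with rfl | rfl
      · rw [mate_pos_zero] at h2; simp at h2
      · rw [mate_pos_one] at h2; simp at h2
    · rw [← h2, Equiv.apply_symm_apply]
  have hex : ∀ l, σ (pos N (l, 0)) = pos N (blk (σ (pos N (l, 0))), 0) := by
    intro l
    have h1 := hσ.1 l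
    rw [hmate] at h1
    obtain ⟨m, f, h3⟩ := exists_pos (σ (pos N (l, 0)))
    rw [h3] at h1 ⊢
    have hf : f = 0 ∨ f = 1 := by omega
    rcases hf with rfl | rfl
    · rw [blk_pos]
    · rw [mate_pos_one] at h1; simp [pos_lt_pos_iff] at h1
  have hmono : StrictMono fun l => blk (σ (pos N (l, 0))) := by
    intro l m hlm
    have h1 := hσ.2 hlm
    dsimp only at h1
    rw [hex l, hex m, pos_lt_pos_iff] at h1
    simpa using h1
  have hid : ∀ l, blk (σ (pos N (l, 0))) = l := by
    exact congrFun hmono.eq_id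
  ext1 i
  obtain ⟨l, e, rfl⟩ := exists_pos i
  have he : e = 0 ∨ e = 1 := by omega
  rcases he with rfl | rfl
  · rw [hex, hid]; rfl
  · rw [hmate, hex, hid, mate_pos_zero]; rfl

/-- The constant is found at the nodes `-1, 1, -2, 2, …`, where only the trivial pairing
contributes. -/
theorem altNumer_eq (x : Fin (2 * N) → ℝ) :
    altNumer x = blockCard N * pairProd (fun i j => x j - x i) Finset.univ := by
  classical
  obtain ⟨c, hc⟩ := exists_altNumer_eq N
  have h1 : altNumer (oppositeNodes N) = blockCard N * blockNumer (oppositeNodes N) := by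
    rw [altNumer, sum_perm_eq_blockCard_mul, Finset.sum_eq_single 1]
    · simp
    · intro σ hσ hne
      simp only [Finset.mem_filter, Finset.mem_univ, true_and] at hσ
      rw [mul_eq_zero]
      right
      by_contra h
      exact hne (eq_one_of_isPairing hσ h)
    · intro h
      exact (h (by simp [isPairing_one])).elim
    · intro σ h
      rw [Equiv.Perm.coe_mul, ← Function.comp_assoc, blockNumer_comp_blockPerm,
        Equiv.Perm.sign_mul]
      push_cast
      linear_combination (((Equiv.Perm.sign σ : ℤ) : ℝ) * blockNumer (oppositeNodes N ∘ σ)) *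
        sign_mul_sign (R := ℝ) (blockPerm h)
  rw [hc, pairProd_oppositeNodes] at h1
  rw [hc, mul_right_cancel₀ blockNumer_oppositeNodes_ne_zero h1]

/-- Schur's Pfaffian, as a sum over all permutations. -/
theorem sum_perm_schur {x : Fin (2 * N) → ℝ} (hx : ∀ i j, i ≠ j → x i + x j ≠ 0) :
    ∑ σ : Equiv.Perm (Fin (2 * N)), ((Equiv.Perm.sign σ : ℤ) : ℝ) *
      ∏ l, (x (σ (pos N (l, 1))) - x (σ (pos N (l, 0)))) /
        (x (σ (pos N (l, 1))) + x (σ (pos N (l, 0)))) =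
    blockCard N * pairProd (fun i j => (x j - x i) / (x j + x i)) Finset.univ := by
  let Γ := pairProd (fun i j => x j + x i) Finset.univ
  have hΓ : Γ ≠ 0 := Finset.prod_ne_zero_iff.mpr fun p hp => by
    simp only [Finset.mem_filter] at hp
    exact hx _ _ hp.2.ne'
  have h1 : pairProd (fun i j => (x j - x i) / (x j + x i)) Finset.univ =
      pairProd (fun i j => x j - x i) Finset.univ / Γ := Finset.prod_div_distrib _ _
  rw [h1, ← mul_div_assoc, ← altNumer_eq, eq_div_iff hΓ, altNumer, Finset.sum_mul]
  refine Finset.sum_congr rfl fun σ _ => ?_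
  rw [mul_assoc]
  congr 1
  have h2 : Γ = pairProd (fun i j => x (σ j) + x (σ i)) Finset.univ :=
    (pairProd_comp_perm (g := fun i j => x j + x i) (fun i j => add_comm _ _) σ).symm
  rw [h2, ← pairProd_ite_blk fun i j => (x (σ j) - x (σ i)) / (x (σ j) + x (σ i)),
    ← pairProd_mul]
  refine pairProd_congr fun i _ j _ hij => ?_
  have : x (σ j) + x (σ i) ≠ 0 := hx _ _ (σ.injective.ne hij.ne')
  simp only [Function.comp_apply]
  split_ifs
  · rw [div_mul_cancel₀ _ this]
  · rw [one_mul]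

end Schur

/-! ### Expansion of a Pfaffian over subsets of nodes -/

section Minors

variable {N : ℕ} {ι : Type*}

/-- A function on the positions amounts to a choice of two values for each block. -/
def blockFunEquiv (N : ℕ) (ι : Type*) : (Fin N → ι × ι) ≃ (Fin (2 * N) → ι) where
  toFun g i := if ((pos N).symm i).2 = 0 then (g (blk i)).1 else (g (blk i)).2
  invFun f l := (f (pos N (l, 0)), f (pos N (l, 1)))
  left_inv g := by
    funext l
    simp
  right_inv f := by
    funext i
    obtain ⟨l, e, rfl⟩ := exists_pos i
    have he : e = 0 ∨ e = 1 := by omega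
    rcases he with rfl | rfl <;> simp

theorem blockFunEquiv_symm_apply (f : Fin (2 * N) → ι) (l : Fin N) :
    (blockFunEquiv N ι).symm f l = (f (pos N (l, 0)), f (pos N (l, 1))) := rfl

variable [LinearOrder ι] [Fintype ι]

theorem prod_pos {R : Type*} [CommMonoid R] (g : Fin (2 * N) → R) :
    ∏ l, g (pos N (l, 0)) * g (pos N (l, 1)) = ∏ i, g i := by
  rw [← Equiv.prod_comp (pos N), Fintype.prod_prod_type]
  simp [Fin.prod_univ_two]

/-- A sum over the functions with a prescribed image of full size is a sum over the orderings of
that image. -/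
theorem sum_image_eq {k : ℕ} (G : (Fin k → ι) → ℝ) {J : Finset ι} (h : J.card = k) :
    ∑ f : Fin k → ι with Finset.univ.image f = J, G f =
      ∑ ρ : Equiv.Perm (Fin k), G (J.orderEmbOfFin h ∘ ρ) := by
  symm
  refine Finset.sum_bij (fun ρ _ => J.orderEmbOfFin h ∘ ρ) ?_ ?_ ?_ fun _ _ => rfl
  · intro ρ _
    simp only [Finset.mem_filter, Finset.mem_univ, true_and]
    rw [← Finset.image_image, Finset.image_univ_equiv, Finset.image_orderEmbOfFin_univ]
  · intro ρ _ ρ' _ he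
    exact Equiv.ext fun i => (J.orderEmbOfFin h).injective (congrFun he i)
  · intro f hf
    simp only [Finset.mem_filter, Finset.mem_univ, true_and] at hf
    have hmem : ∀ i, f i ∈ J := fun i => hf ▸ Finset.mem_image_of_mem _ (Finset.mem_univ i)
    have hinj : Function.Injective f := by
      have : (Finset.univ.image f).card = (Finset.univ : Finset (Fin k)).card := by
        rw [hf, h, Finset.card_univ, Fintype.card_fin]
      exact Set.injOn_univ.mp (by simpa using Finset.card_image_iff.mp this)
    let ρ : Fin k → Fin k := fun i => (J.orderIsoOfFin h).symm ⟨f i, hmem i⟩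
    have hρ : Function.Injective ρ := by
      intro i j hij
      exact hinj (congrArg Subtype.val ((J.orderIsoOfFin h).symm.injective hij))
    refine ⟨Equiv.ofBijective ρ hρ.bijective_of_finite, Finset.mem_univ _, ?_⟩
    funext i
    simp [ρ, ← Finset.coe_orderIsoOfFin_apply]

/-- The Pfaffian of `V B S B Vᵀ`, with `B` diagonal and `S` Schur's matrix of the nodes `x`, as a
sum over sets `J` of `2N` nodes; `d J` is the maximal minor of `V` with columns in `J`. -/
theorem pfaffian_eq_sum_minors {x : ι → ℝ} (hx : ∀ i j, i ≠ j → x i + x j ≠ 0) (β : ι → ℝ)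
    (V : Fin (2 * N) → ι → ℝ) {d : Finset ι → ℝ}
    (hd : ∀ f : Fin (2 * N) → ι, StrictMono f →
      (Matrix.of fun i j => V i (f j)).det = d (Finset.univ.image f))
    {A : Matrix (Fin (2 * N)) (Fin (2 * N)) ℝ}
    (hA : ∀ i j, A i j = ∑ p, ∑ q, V i p * V j q * (β p * β q) * ((x q - x p) / (x q + x p))) :
    pfaffian A = ∑ J : Finset ι with J.card = 2 * N,
      (∏ p ∈ J, β p) * d J * pairProd (fun i j => (x j - x i) / (x j + x i)) J := by
  have hanti : ∀ i j, A i j = -A j i := by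
    intro i j
    rw [hA, hA, Finset.sum_comm, ← Finset.sum_neg_distrib]
    refine Finset.sum_congr rfl fun p _ => ?_
    rw [← Finset.sum_neg_distrib]
    refine Finset.sum_congr rfl fun q _ => ?_
    rw [← neg_sub (x q) (x p), add_comm (x p) (x q), neg_div]
    ring
  obtain ⟨s, hs⟩ : ∃ s : (Fin (2 * N) → ι) → ℝ, s = fun f => ∏ l,
    (x (f (pos N (l, 1))) - x (f (pos N (l, 0)))) /
      (x (f (pos N (l, 1))) + x (f (pos N (l, 0)))) := ⟨_, rfl⟩
  obtain ⟨G, hG⟩ : ∃ G : (Fin (2 * N) → ι) → ℝ, G = fun f =>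
    (Matrix.of fun i j => V i (f j)).det * (∏ i, β (f i)) * s f := ⟨_, rfl⟩
  apply mul_left_cancel₀ (blockCard_ne_zero N)
  have h1 : blockCard N * pfaffian A = ∑ f, G f := by
    rw [← sum_perm_eq_pfaffian hanti]
    have h2 : ∀ σ : Equiv.Perm (Fin (2 * N)),
        ∏ l, A (σ (pos N (l, 0))) (σ (pos N (l, 1))) =
          ∑ f : Fin (2 * N) → ι, (∏ i, V (σ i) (f i)) * (∏ i, β (f i)) * s f := by
      intro σ
      simp only [hA, ← Fintype.sum_prod_type']
      rw [Fintype.prod_sum, ← Equiv.sum_comp (blockFunEquiv N ι).symm]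
      refine Finset.sum_congr rfl fun f _ => ?_
      simp only [blockFunEquiv_symm_apply, Finset.prod_mul_distrib, hs]
      rw [← prod_pos fun i => V (σ i) (f i), ← prod_pos fun i => β (f i)]
      simp only [Finset.prod_mul_distrib]
    simp only [h2, Finset.mul_sum]
    rw [Finset.sum_comm]
    refine Finset.sum_congr rfl fun f _ => ?_
    simp only [hG, Matrix.det_apply', Finset.sum_mul, Matrix.of_apply]
    exact Finset.sum_congr rfl fun σ _ => by ring
  rw [h1, ← Finset.sum_fiberwise Finset.univ fun f : Fin (2 * N) → ι => Finset.univ.image f,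
    Finset.sum_filter, Finset.mul_sum]
  refine Finset.sum_congr rfl fun J _ => ?_
  split_ifs with hJ
  · rw [sum_image_eq G hJ]
    have himg : Finset.univ.image (J.orderEmbOfFin hJ) = J := Finset.image_orderEmbOfFin_univ J hJ
    generalize J.orderEmbOfFin hJ = e at himg
    have h3 : ∀ ρ : Equiv.Perm (Fin (2 * N)), G (e ∘ ρ) =
        d J * (∏ p ∈ J, β p) * (((Equiv.Perm.sign ρ : ℤ) : ℝ) * s (e ∘ ρ)) := by
      intro ρ
      have h4 := Matrix.det_permute' ρ (Matrix.of fun i j => V i (e j))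
      rw [hd e e.strictMono, himg] at h4
      have h5 : ∏ i, β ((e ∘ ρ) i) = ∏ p ∈ J, β p := by
        rw [← himg, Finset.prod_image fun i _ j _ h => e.injective h]
        exact Equiv.prod_comp ρ fun i => β (e i)
      have h6 : (Matrix.of fun i j => V i ((e ∘ ρ) j)) =
        (Matrix.of fun i j => V i (e j)).submatrix id ρ := rfl
      rw [hG]
      dsimp only
      rw [h5, h6, h4]
      ring
    rw [Finset.sum_congr rfl fun ρ _ => h3 ρ, ← Finset.mul_sum]
    have h7 := sum_perm_schur (x := x ∘ e) fun i j hij => hx _ _ (e.injective.ne hij)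
    have h8 : pairProd (fun i j => (x j - x i) / (x j + x i)) J =
        pairProd (fun i j => (x (e j) - x (e i)) / (x (e j) + x (e i))) Finset.univ := by
      rw [← himg, pairProd_image_of_strictMono _ e.strictMono]
    simp only [Function.comp_apply] at h7
    simp only [hs, Function.comp_apply]
    rw [h7, h8]
    ring
  · rw [mul_zero]
    refine Finset.sum_eq_zero fun f hf => ?_
    simp only [Finset.mem_filter, Finset.mem_univ, true_and] at hf
    have hninj : ¬ Function.Injective f := by
      intro hinj
      apply hJ
      rw [← hf, Finset.card_image_of_injective _ hinj, Finset.card_univ, Fintype.card_fin]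
    rw [Function.Injective] at hninj
    push Not at hninj
    obtain ⟨i, j, hij, hne⟩ := hninj
    rw [hG]
    dsimp only
    rw [Matrix.det_zero_of_column_eq hne fun k => by simp [hij], zero_mul, zero_mul]

end Minors

section Vandermonde

variable {ι : Type*} [LinearOrder ι]

theorem det_powers {k : ℕ} (x : ι → ℝ) {f : Fin k → ι} (hf : StrictMono f) :
    (Matrix.of fun i j : Fin k => x (f j) ^ (i : ℕ)).det =
      pairProd (fun i j => x j - x i) (Finset.univ.image f) := by
  rw [pairProd_image_of_strictMono _ hf, pairProd_eq]
  have h : (Matrix.of fun i j : Fin k => x (f j) ^ (i : ℕ)) =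
      (Matrix.vandermonde (x ∘ f)).transpose := rfl
  rw [h, Matrix.det_transpose, Matrix.det_vandermonde]
  refine Finset.prod_congr rfl fun i _ => ?_
  rw [← Finset.prod_filter]
  refine Finset.prod_congr ?_ fun j _ => rfl
  ext j; simp

theorem pairProd_insert_of_lt {R : Type*} [CommMonoid R] (g : ι → ι → R) {a : ι} {J : Finset ι}
    (h : ∀ j ∈ J, a < j) : pairProd g (insert a J) = (∏ j ∈ J, g a j) * pairProd g J := by
  -- Only the values `g i j` with `i < j` matter, so `g` may be replaced by a symmetric function.
  have hs : ∀ K : Finset ι, pairProd g K = pairProd (fun i j => g (min i j) (max i j)) K :=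
    fun K => pairProd_congr fun i _ j _ hij => by rw [min_eq_left hij.le, max_eq_right hij.le]
  rw [hs, hs, pairProd_insert (fun i j => by rw [min_comm, max_comm]) fun ha => (h a ha).false]
  congr 1
  exact Finset.prod_congr rfl fun j hj => by
    rw [min_eq_left (h j hj).le, max_eq_right (h j hj).le]

end Vandermonde

/-! ### The double integrals -/

section Integrals

theorem measurableSet_region (t : ℝ) : MeasurableSet (region t) :=
  (measurableSet_lt measurable_fst measurable_snd).inter
    (measurableSet_lt measurable_snd measurable_const)

theorem integrableOn_region_exp {a c : ℝ} (ha : 0 < a) (hc : 0 < c) (t : ℝ) :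
    IntegrableOn (fun p : ℝ × ℝ => Real.exp (a * p.1) * Real.exp (c * p.2)) (region t) := by
  have h1 : IntegrableOn (fun p : ℝ × ℝ => Real.exp (a * p.1) * Real.exp (c * p.2))
      (Set.Iic t ×ˢ Set.Iic t) := by
    rw [IntegrableOn, Measure.volume_eq_prod, ← Measure.prod_restrict]
    exact (integrableOn_exp_mul_Iic ha t).mul_prod (integrableOn_exp_mul_Iic hc t)
  exact h1.mono_set fun p hp => ⟨(hp.1.trans hp.2).le, hp.2.le⟩

/-- Fubini's theorem, integrating over `t₁ < t₂` first. -/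
theorem integral_region_exp {a c : ℝ} (ha : 0 < a) (hc : 0 < c) (t : ℝ) :
    ∫ p in region t, Real.exp (a * p.1) * Real.exp (c * p.2) =
      Real.exp (a * t) * Real.exp (c * t) / (a * (a + c)) := by
  have hi := (integrable_indicator_iff (measurableSet_region t)).mpr
    (integrableOn_region_exp ha hc t)
  rw [← integral_indicator (measurableSet_region t), Measure.volume_eq_prod,
    integral_prod_symm _ (by rwa [Measure.volume_eq_prod] at hi)]
  have h1 : ∀ y, (∫ x, (region t).indicator
      (fun p : ℝ × ℝ => Real.exp (a * p.1) * Real.exp (c * p.2)) (x, y)) =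
      (Set.Iio t).indicator (fun y => Real.exp ((a + c) * y) / a) y := by
    intro y
    by_cases hy : y < t
    · have h2 : (fun x => (region t).indicator
          (fun p : ℝ × ℝ => Real.exp (a * p.1) * Real.exp (c * p.2)) (x, y)) =
          (Set.Iio y).indicator fun x => Real.exp (a * x) * Real.exp (c * y) := by
        funext x
        by_cases hx : x < y <;> simp [Set.indicator, region, hx, hy]
      rw [h2, integral_indicator measurableSet_Iio, integral_mul_const,
        ← integral_Iic_eq_integral_Iio,
        integral_exp_mul_Iic ha, Set.indicator_of_mem (Set.mem_Iio.mpr hy), add_mul, Real.exp_add]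
      ring
    · have h2 : (fun x => (region t).indicator
          (fun p : ℝ × ℝ => Real.exp (a * p.1) * Real.exp (c * p.2)) (x, y)) = fun _ => 0 := by
        funext x
        simp [Set.indicator, region, hy]
      rw [h2, Set.indicator_of_notMem (mt Set.mem_Iio.mp hy), integral_zero]
  simp only [h1]
  rw [integral_indicator measurableSet_Iio, integral_div, ← integral_Iic_eq_integral_Iio,
    integral_exp_mul_Iic (add_pos ha hc), add_mul, Real.exp_add]
  have : a + c ≠ 0 := (add_pos ha hc).ne'
  field_simp

variable {n : ℕ} {ζ : Fin n → ℝ} {b : Fin n → ℝ → ℝ}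

theorem entryIntegrand_eq (hb : ∀ j t, HasDerivAt (b j) (ζ j * b j t) t) (i j : ℕ) :
    entryIntegrand ζ b i j = fun p => ∑ q : Fin n × Fin n,
      (ζ q.1 ^ (i + 1) * ζ q.2 ^ (j + 1) - ζ q.2 ^ (i + 1) * ζ q.1 ^ (j + 1)) *
        (b q.1 0 * b q.2 0) * (Real.exp (ζ q.1 * p.1) * Real.exp (ζ q.2 * p.2)) := by
  funext p
  have hb' : ∀ q t, b q t = b q 0 * Real.exp (ζ q * t) := fun q t =>
    congrFun (flow_eq_exp hb q) t
  simp only [entryIntegrand, moment, Fintype.sum_prod_type]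
  rw [Finset.sum_mul_sum, Finset.sum_mul_sum, Finset.sum_comm (f := fun q r =>
    ζ q ^ (i + 1) * b q p.2 * (ζ r ^ (j + 1) * b r p.1)), ← Finset.sum_sub_distrib]
  refine Finset.sum_congr rfl fun q _ => ?_
  rw [← Finset.sum_sub_distrib]
  refine Finset.sum_congr rfl fun r _ => ?_
  rw [hb' q p.1, hb' r p.2]
  ring

theorem integrableOn_entryIntegrand (hζ : ∀ j, 0 < ζ j)
    (hb : ∀ j t, HasDerivAt (b j) (ζ j * b j t) t) (i j : ℕ) (t : ℝ) :
    IntegrableOn (entryIntegrand ζ b i j) (region t) := by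
  rw [entryIntegrand_eq hb]
  exact integrable_finsetSum _ fun q _ => (integrableOn_region_exp (hζ _) (hζ _) t).const_mul _

/-- The entries of the Pfaffian form the matrix `V B S B Vᵀ` with `V = (ζ_p ^ i)` and Schur's
matrix `S`. -/
theorem entry_eq (hζ : ∀ j, 0 < ζ j) (hb : ∀ j t, HasDerivAt (b j) (ζ j * b j t) t)
    (i j : ℕ) (t : ℝ) :
    entry ζ b t i j = ∑ p, ∑ q, ζ p ^ i * ζ q ^ j * (b p t * b q t) *
      ((ζ q - ζ p) / (ζ q + ζ p)) := by
  have hb' : ∀ q t, b q t = b q 0 * Real.exp (ζ q * t) := fun q t =>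
    congrFun (flow_eq_exp hb q) t
  rw [entry, entryIntegrand_eq hb, integral_finsetSum _ fun q _ =>
    (integrableOn_region_exp (hζ _) (hζ _) t).const_mul _]
  simp only [integral_const_mul, integral_region_exp (hζ _) (hζ _), Fintype.sum_prod_type]
  -- Both sides agree after averaging each of them with its transpose in `p` and `q`.
  have h1 : ∀ u v : Fin n → Fin n → ℝ, (∀ p q, u p q + u q p = v p q + v q p) →
      ∑ p, ∑ q, u p q = ∑ p, ∑ q, v p q := by
    intro u v huv
    have h2 : ∑ p, ∑ q, (u p q + u q p) = ∑ p, ∑ q, (v p q + v q p) :=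
      Finset.sum_congr rfl fun p _ => Finset.sum_congr rfl fun q _ => huv p q
    simp only [Finset.sum_add_distrib] at h2
    rw [Finset.sum_comm (f := fun p q => u q p), Finset.sum_comm (f := fun p q => v q p)] at h2
    linarith
  refine h1 _ _ fun p q => ?_
  have hp := (hζ p).ne'
  have hq := (hζ q).ne'
  have hpq : ζ p + ζ q ≠ 0 := (add_pos (hζ p) (hζ q)).ne'
  rw [hb' p t, hb' q t, add_comm (ζ q) (ζ p)]
  field_simp
  ring

end Integrals

/-! ### The sums as Pfaffians -/

section Main

variable {n : ℕ} {ζ : Fin n → ℝ} {b : Fin n → ℝ → ℝ}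

/-- One factor `Δ_J` is a Vandermonde minor, and `Δ_J / Γ_J` is Schur's Pfaffian. -/
theorem tau_eq_sum_pairProd (ζ : Fin n → ℝ) (b : Fin n → ℝ → ℝ) (k : ℤ) (t : ℝ) :
    tau ζ b k t = ∑ J : Finset (Fin n) with (J.card : ℤ) = k,
      (∏ j ∈ J, b j t) * pairProd (fun i j => ζ j - ζ i) J *
        pairProd (fun i j => (ζ j - ζ i) / (ζ j + ζ i)) J := by
  refine Finset.sum_congr rfl fun J _ => ?_
  have h : pairProd (fun i j => (ζ j - ζ i) / (ζ j + ζ i)) J = Delta ζ J / Gam ζ J :=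
    Finset.prod_div_distrib _ _
  rw [h, show pairProd (fun i j => ζ j - ζ i) J = Delta ζ J from rfl]
  ring

theorem tau_eq_pfEven (hζ : ∀ j, 0 < ζ j) (hb : ∀ j t, HasDerivAt (b j) (ζ j * b j t) t)
    (N : ℕ) (t : ℝ) : tau ζ b (2 * (N : ℤ)) t = pfEven ζ b N t := by
  rw [pfEven, pfaffian_eq_sum_minors (fun i j _ => (add_pos (hζ i) (hζ j)).ne')
    (fun p => b p t) (fun i p => ζ p ^ (i : ℕ)) (fun f hf => det_powers ζ hf)
    (A := Matrix.of fun x y => entry ζ b t (x : ℕ) (y : ℕ))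
    (fun i j => entry_eq hζ hb i j t), tau_eq_sum_pairProd]
  refine Finset.sum_congr ?_ fun J _ => rfl
  ext J
  simp only [Finset.mem_filter, Finset.mem_univ, true_and]
  omega

/-- The rows of the matrix `V` for the bordered Pfaffian: the node `0` is added in front of the
nodes `ζ`, and the row of `d₀` is the unit vector at this node. -/
def borderedPowers (ζ : Fin n → ℝ) : ℕ → Fin (n + 1) → ℝ
  | 0 => Fin.cons 1 fun _ => 0
  | i + 1 => Fin.cons 0 fun p => ζ p ^ i

/-- The bordered matrix has the same form as the matrix of the entries, for the nodes `0, ζ`: the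
factor `(ζ_p - 0) / (ζ_p + 0) = 1` produces the entries `(d₀, i) = f_i`. -/
theorem entryD_eq (hζ : ∀ j, 0 < ζ j) (hb : ∀ j t, HasDerivAt (b j) (ζ j * b j t) t)
    (t : ℝ) (i j : ℕ) :
    entryD ζ b t i j = ∑ p, ∑ q, borderedPowers ζ i p * borderedPowers ζ j q *
      ((Fin.cons 1 fun p => b p t : Fin (n + 1) → ℝ) p *
        (Fin.cons 1 fun p => b p t : Fin (n + 1) → ℝ) q) *
      (((Fin.cons 0 ζ : Fin (n + 1) → ℝ) q - (Fin.cons 0 ζ : Fin (n + 1) → ℝ) p) /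
        ((Fin.cons 0 ζ : Fin (n + 1) → ℝ) q + (Fin.cons 0 ζ : Fin (n + 1) → ℝ) p)) := by
  have hne : ∀ p, ζ p ≠ 0 := fun p => (hζ p).ne'
  rcases i with _ | i <;> rcases j with _ | j <;>
    simp [entryD, borderedPowers, Fin.sum_univ_succ, moment, entry_eq hζ hb, hne, neg_div]

/-- A maximal minor of the bordered matrix vanishes unless it contains the column of the node `0`;
in that case expansion along the row of `d₀` leaves a Vandermonde determinant. -/
theorem det_borderedPowers {M : ℕ} (ζ : Fin n → ℝ) {f : Fin (M + 1) → Fin (n + 1)}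
    (hf : StrictMono f) :
    (Matrix.of fun i j : Fin (M + 1) => borderedPowers ζ i (f j)).det =
      if 0 ∈ Finset.univ.image f then
        pairProd (fun i j => ζ j - ζ i) {p | Fin.succ p ∈ Finset.univ.image f} else 0 := by
  split_ifs with h0
  · have hf0 : f 0 = 0 := by
      simp only [Finset.mem_image, Finset.mem_univ, true_and] at h0
      obtain ⟨i, hi⟩ := h0
      exact le_antisymm (hi ▸ hf.monotone (Fin.zero_le i)) (Fin.zero_le _)
    have hpos : ∀ i : Fin M, f i.succ ≠ 0 := fun i h =>
      ((hf (Fin.succ_pos i)).trans_eq (h.trans hf0.symm)).false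
    obtain ⟨g, hg⟩ : ∃ g : Fin M → Fin n, ∀ i, f i.succ = (g i).succ :=
      ⟨fun i => (f i.succ).pred (hpos i), fun i => (Fin.succ_pred _ _).symm⟩
    have hgm : StrictMono g := by
      intro i j hij
      have := hf (Fin.succ_lt_succ_iff.mpr hij)
      rwa [hg, hg, Fin.succ_lt_succ_iff] at this
    have himg : ({p | Fin.succ p ∈ Finset.univ.image f} : Finset (Fin n)) =
        Finset.univ.image g := by
      ext p
      simp only [Finset.mem_filter, Finset.mem_image, Finset.mem_univ, true_and]
      rw [Fin.exists_fin_succ, hf0]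
      simp [hg, (Fin.succ_ne_zero p).symm]
    rw [himg, ← det_powers ζ hgm, Matrix.det_succ_row_zero, Fin.sum_univ_succ,
      Finset.sum_eq_zero]
    · simp only [Matrix.of_apply, hf0, borderedPowers, Fin.val_zero, pow_zero, Fin.cons_zero,
        mul_one, one_mul, add_zero]
      congr 1
      ext i j
      simp [hg]
    · intro j _
      simp [hg, borderedPowers]
  · refine Matrix.det_eq_zero_of_row_eq_zero 0 fun j => ?_
    have hj : f j ≠ 0 := fun h => h0 (h ▸ Finset.mem_image_of_mem f (Finset.mem_univ j))
    obtain ⟨p, hp⟩ := Fin.exists_succ_eq.mpr hj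
    simp [← hp, borderedPowers]

theorem tau_eq_pfOdd (hζ : ∀ j, 0 < ζ j) (hb : ∀ j t, HasDerivAt (b j) (ζ j * b j t) t)
    {N : ℕ} (hN : 1 ≤ N) (t : ℝ) : tau ζ b (2 * (N : ℤ) - 1) t = pfOdd ζ b N t := by
  obtain ⟨M, rfl⟩ : ∃ M, N = M + 1 := ⟨N - 1, by omega⟩
  have hx : ∀ i j : Fin (n + 1), i ≠ j →
      (Fin.cons 0 ζ : Fin (n + 1) → ℝ) i + (Fin.cons 0 ζ : Fin (n + 1) → ℝ) j ≠ 0 := by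
    intro i j hij
    refine Fin.cases (fun hij => ?_) (fun p hij => ?_) i hij <;>
      refine Fin.cases (fun hij => ?_) (fun q hij => ?_) j hij
    · exact (hij rfl).elim
    · simpa using (hζ q).ne'
    · simpa using (hζ p).ne'
    · simpa using (add_pos (hζ p) (hζ q)).ne'
  rw [pfOdd, pfaffian_eq_sum_minors (N := M + 1) hx (Fin.cons 1 fun p => b p t)
    (fun i p => borderedPowers ζ i p)
    (fun f hf => det_borderedPowers (M := 2 * M + 1) ζ hf)
    (d := fun J => if 0 ∈ J then
        pairProd (fun i j => ζ j - ζ i) {p | Fin.succ p ∈ J} else 0)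
    (A := Matrix.of fun x y => entryD ζ b t (x : ℕ) (y : ℕ))
    (fun i j => entryD_eq hζ hb t i j), tau_eq_sum_pairProd, Finset.sum_filter,
    Finset.sum_filter]
  have huniv : (Finset.univ : Finset (Fin (n + 1))) = insert 0 (Finset.univ.image Fin.succ) := by
    ext p
    refine Fin.cases ?_ (fun q => ?_) p <;> simp
  have h0 : ∀ J : Finset (Fin n), (0 : Fin (n + 1)) ∉ J.image Fin.succ := fun J => by simp
  rw [← Finset.powerset_univ (α := Fin (n + 1)), huniv, Finset.sum_powerset_insert (h0 _),
    Finset.powerset_image, Finset.sum_image (Finset.image_injective (Fin.succ_injective n)).injOn,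
    Finset.sum_image (Finset.image_injective (Fin.succ_injective n)).injOn,
    Finset.powerset_univ]
  symm
  -- The minors without the column of the node `0` vanish.
  refine (add_eq_right.mpr (Finset.sum_eq_zero fun J _ => by simp)).trans ?_
  symm
  refine Finset.sum_congr rfl fun J _ => ?_
  have hcard : (insert 0 (J.image Fin.succ)).card = J.card + 1 := by
    rw [Finset.card_insert_of_notMem (h0 J),
      Finset.card_image_of_injective _ (Fin.succ_injective n)]
  have hmem : ({p | Fin.succ p ∈ insert 0 (J.image Fin.succ)} : Finset (Fin n)) = J := by
    ext p; simp
  rw [hcard, if_pos (Finset.mem_insert_self _ _), hmem, Finset.prod_insert (h0 J),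
    Finset.prod_image fun _ _ _ _ h => Fin.succ_injective n h,
    pairProd_insert_of_lt _ fun j hj => ?_,
    pairProd_image_of_strictMono _ (Fin.strictMono_succ),
    Finset.prod_image fun _ _ _ _ h => Fin.succ_injective n h]
  · refine if_congr (by push_cast; omega) ?_ rfl
    simp only [Fin.cons_zero, Fin.cons_succ, one_mul]
    rw [Finset.prod_eq_one (s := J) (f := fun x => (ζ x - 0) / (ζ x + 0)), one_mul]
    intro p _
    rw [sub_zero, add_zero, div_self (hζ p).ne']
  · obtain ⟨p, _, rfl⟩ := Finset.mem_image.mp hj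
    exact Fin.succ_pos p

end Main

end BToda

theorem mainTheorem3 (n : ℕ) (ζ : Fin n → ℝ) (b : Fin n → ℝ → ℝ)
    (hζ_pos : ∀ j, 0 < ζ j) (hζ_mono : StrictMono ζ)
    (hb_pos : ∀ j, 0 < b j 0)
    (hb_ode : ∀ j t, HasDerivAt (b j) (ζ j * b j t) t) :
    -- boundary values
    (∀ (k : ℤ) (t : ℝ), (k < 0 ∨ (n : ℤ) < k) → BToda.tau ζ b k t = 0) ∧
    -- the double integrals converge absolutely, and the sums are Pfaffians
    (∀ (i j : ℕ) (t : ℝ),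
      IntegrableOn (BToda.entryIntegrand ζ b i j) (BToda.region t) volume) ∧
    (∀ (N : ℕ) (t : ℝ), BToda.tau ζ b (2 * (N : ℤ)) t = BToda.pfEven ζ b N t) ∧
    (∀ (N : ℕ) (t : ℝ), 1 ≤ N →
      BToda.tau ζ b (2 * (N : ℤ) - 1) t = BToda.pfOdd ζ b N t) ∧
    -- the bilinear lattice
    (∀ k : ℤ, ContDiff ℝ 2 (BToda.tau ζ b k)) ∧
    (∀ (k : ℤ) (t : ℝ), 0 ≤ k → k ≤ (n : ℤ) →
      deriv (deriv (BToda.tau ζ b k)) t * BToda.tau ζ b k t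
          - (deriv (BToda.tau ζ b k) t) ^ 2
        = BToda.tau ζ b (k - 1) t * deriv (BToda.tau ζ b (k + 1)) t
          - deriv (BToda.tau ζ b (k - 1)) t * BToda.tau ζ b (k + 1) t) := by
  refine ⟨fun k t hk => ?_, BToda.integrableOn_entryIntegrand hζ_pos hb_ode,
    BToda.tau_eq_pfEven hζ_pos hb_ode, fun N t hN => BToda.tau_eq_pfOdd hζ_pos hb_ode hN t,
    BToda.contDiff_tau hb_ode, fun k t _ _ => ?_⟩
  · refine Finset.sum_eq_zero fun J hJ => ?_
    have h1 : J.card ≤ n := by simpa using J.card_le_univ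
    simp only [Finset.mem_filter] at hJ
    omega
  · rw [BToda.deriv_deriv_tau hb_ode]
    simp only [BToda.deriv_tau hb_ode, BToda.tau_eq_tauMoment]
    exact BToda.tauMoment_bilinear hζ_pos _ k
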